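/- Let $H=(V,F)$ be a finite hypergraph with $n=|V|\ge 2$ vertices, all of whose hyperedges are (distinct) subsets of $V$ of size exactly $k\ge 1$, and let $\Delta$ be its maximum degree, i.e. the maximum over $v\in V$ of the number of hyperedges containing $v$. An independent set is a set $I\subseteq V$ that contains no hyperedge as a subset; let $\Omega$ be the set of all independent sets and $\pi$ the uniform distribution on $\Omega$. The (discrete-time) Glauber dynamics is the Markov chain on $\Omega$ that, at each step, from the current state $I$, chooses a vertex $v\in V$ uniformly at random and then, with probability $1/2$, moves to $I\setminus\{v\}$, and with probability $1/2$, moves to $I\cup\{v\}$ if this set is independent and stays at $I$ otherwise. Let $P$ be its transition matrix and let $$t_{\mathrm{mix}}=\inf\Big\{t\in\mathbb{N}:\ \max_{I\in\Omega}\ \tfrac12\sum_{J\in\Omega}\big|P^t(I,J)-\pi(J)\big|<\tfrac14\Big\}.$$ There is an absolute constant $C>0$ such that for every such hypergraph, $t_{\mathrm{mix}}$ is finite and $$t_{\mathrm{mix}}\le C\,n\log n$$ whenever one of the following two conditions holds: 1. $\Delta\le 2^{k/2}/(\sqrt8\,k^2)$; 2. $\Delta\le 2^{k}/(9k^3)$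 and $H$ is linear, i.e. any two distinct hyperedges share at most one vertex. -/

import Mathlib

open scoped Hypergraph

noncomputable section

namespace Hypergraph

variable {V : Type*}

/-- Every hyperedge has exactly `k` vertices. -/
def IsUniform (H : Hypergraph V) (k : ℕ) : Prop :=
  ∀ e ∈ E(H), e.ncard = k

/-- No two distinct hyperedges share more than one vertex. -/
def IsLinear (H : Hypergraph V) : Prop :=
  ∀ e ∈ E(H), ∀ f ∈ E(H), e ≠ f → (e ∩ f).ncard ≤ 1

/-- The degree of `v`: the number of hyperedges containing `v`. -/
def degree (H : Hypergraph V) (v : V) : ℕ :=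
  {e | e ∈ E(H) ∧ v ∈ e}.ncard

/-- The maximum degree over all vertices (used for hypergraphs whose vertex set is all of `V`). -/
def maxDegree [Fintype V] (H : Hypergraph V) : ℕ :=
  Finset.univ.sup fun v => H.degree v

/-- `I` is independent if no hyperedge is a subset of `I`. A set `I` stands for the configuration
in `{0,1}^V` whose spin at `v` is `1` exactly when `v ∈ I`. -/
def IsIndep (H : Hypergraph V) (I : Finset V) : Prop :=
  ∀ e ∈ E(H), ¬ e ⊆ (I : Set V)

/-- The state space `Ω` of independent sets. -/
abbrev IndepSet (H : Hypergraph V) : Type _ := {I : Finset V // H.IsIndep I}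

instance [Fintype V] (H : Hypergraph V) : Fintype H.IndepSet := Fintype.ofFinite _

theorem IsIndep.erase [DecidableEq V] {H : Hypergraph V} {I : Finset V} (hI : H.IsIndep I)
    (v : V) : H.IsIndep (I.erase v) :=
  fun e he h => hI e he (h.trans (Finset.coe_subset.2 (Finset.erase_subset v I)))

/-- Set the spin at `v` to `0`. -/
def update0 [DecidableEq V] (H : Hypergraph V) (v : V) (σ : H.IndepSet) : H.IndepSet :=
  ⟨σ.1.erase v, σ.2.erase v⟩

open Classical in
/-- Set the spin at `v` to `1` if the result is an independent set; otherwise do nothing. -/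
def update1 [DecidableEq V] (H : Hypergraph V) (v : V) (σ : H.IndepSet) : H.IndepSet :=
  if h : H.IsIndep (insert v σ.1) then ⟨insert v σ.1, h⟩ else σ

/-- The transition matrix of the discrete-time Glauber dynamics: choose a uniform vertex `v`, then
with probability `1/2` apply `update0` at `v`, and with probability `1/2` apply `update1` at `v`. -/
def glauber [Fintype V] [DecidableEq V] (H : Hypergraph V) : Matrix H.IndepSet H.IndepSet ℝ :=
  fun σ τ => ∑ v : V, (1 / (Fintype.card V : ℝ)) *
    ((1 / 2) * (if H.update0 v σ = τ then 1 else 0) +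
      (1 / 2) * (if H.update1 v σ = τ then 1 else 0))

/-- The uniform distribution on the independent sets. -/
def uniformIndep [Fintype V] (H : Hypergraph V) : H.IndepSet → ℝ :=
  fun _ => 1 / (Fintype.card H.IndepSet : ℝ)

/-- Total variation distance of two distributions on a finite set. -/
def tvDist {Ω : Type*} [Fintype Ω] (μ ν : Ω → ℝ) : ℝ :=
  (1 / 2) * ∑ σ, |μ σ - ν σ|

/-- The mixing time of the Glauber dynamics: the least `t` such that from every initial state the
law after `t` steps is within total variation distance less than `ε` of the uniform distribution
(`⊤` if there is no such `t`). -/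
def mixingTime [Fintype V] [DecidableEq V] (H : Hypergraph V) (ε : ℝ) : ℕ∞ :=
  sInf ((fun t : ℕ => (t : ℕ∞)) ''
    {t : ℕ | ∀ σ : H.IndepSet, tvDist ((H.glauber ^ t) σ) H.uniformIndep < ε})

end Hypergraph

end

/-!
# Rapid mixing of the Glauber dynamics on independent sets of hypergraphs

Two copies of the dynamics are driven by the same sequence of vertices and bits. Since the
transition matrix is symmetric, the uniform distribution is stationary, and the distance to it at
time `T` is at most the maximal probability that two such copies differ at time `T`
(`Hypergraph.tvDist_glauber_pow_le`).

A discrepancy at a vertex `w` goes back to the last update of `w`, at time `s` say: there, a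
hyperedge `e` at `w` blocked the insertion of `w` in exactly one of the copies. So `e` contains
another discrepancy at time `s`, and the most recent bits of all the vertices of `e` are `true`,
an event of probability `2 ^ (-k)` given the updated vertices. Iterating yields a chain of nodes
(hyperedge, time) that reaches back almost to time `0` (`UpdateSeq.exists_linked_chain`). A union
bound over chains is hampered only by the overlaps between the sets of most recent updates of
their nodes. These are controlled by shortening: from each node one moves to the last node of the
chain with which it has an update in common, so that only consecutive nodes can overlap.

* In general every second node has `k` bits of its own, which is a factor `2 ^ (-k / 2)` per node
  (`UpdateSeq.exists_separated_jump_chain`), against which there are about `k ^ 2 * Δ` choices for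
  the next node: a common vertex, a new hyperedge at it, and one of the on average `k` updates of
  the new hyperedge before the common vertex is reached (`UpdateSeq.stepBound_jump`).
* In a linear hypergraph consecutive nodes with different hyperedges share at most one update. Two
  consecutive nodes with the same hyperedge can share many, but the second of them can be
  skipped (`UpdateSeq.exists_separated_hop_chain`). This gives a factor `2 ^ (-(k - 1))` per node,
  against about `k ^ 3 * Δ` choices (`UpdateSeq.stepBound_hop`).

In both cases the expected number of chains, each weighted by the probability of its bits, decays
geometrically in the number of nodes. This remains true when a chain gets the weight `tilt V ^ t`,
where `t` is the time it spans and `tilt V = 1 + 1 / (4 * n)`; hence chains that span a large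
multiple of `n log n` are unlikely (`UpdateSeq.avg_discrepancy_le`). The windows in which all
vertices are updated (`UpdateSeq.Covers`) guarantee that all most recent updates exist, and that
the chain begins and ends near the ends of the time interval.
-/

noncomputable section

namespace UpdateSeq

/-! ### Averages over random update sequences -/

section Average

variable {α β : Type*} [Fintype α] [Inhabited α] [Fintype β] [Inhabited β]

/-- The expectation of `g` at a random sequence whose first `T` entries are independent and
uniform on `α`. The entries from `T` on are fixed to `default`; only functions of the first `T`
entries are of interest. -/
def avg : ℕ → ((ℕ → α) → ℝ) → ℝ
  | 0, g => g fun _ => default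
  | T + 1, g => (∑ a, avg T fun v => g (Function.update v T a)) / Fintype.card α

lemma avg_mono {T : ℕ} {g h : (ℕ → α) → ℝ} (hgh : ∀ v, g v ≤ h v) : avg T g ≤ avg T h := by
  induction T generalizing g h with
  | zero => exact hgh _
  | succ T ih =>
    simp only [avg]
    gcongr
    exact ih fun v => hgh _

lemma avg_const (T : ℕ) (c : ℝ) : avg T (fun _ : ℕ → α => c) = c := by
  induction T with
  | zero => rfl
  | succ T ih => simp [avg, ih]

lemma avg_add (T : ℕ) (g h : (ℕ → α) → ℝ) :
    avg T (fun v => g v + h v) = avg T g + avg T h := by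
  induction T generalizing g h with
  | zero => rfl
  | succ T ih => simp [avg, ih, Finset.sum_add_distrib, add_div]

lemma avg_const_mul (T : ℕ) (c : ℝ) (g : (ℕ → α) → ℝ) :
    avg T (fun v => c * g v) = c * avg T g := by
  induction T generalizing g with
  | zero => rfl
  | succ T ih => simp only [avg, ih, ← Finset.mul_sum, mul_div_assoc]

lemma avg_sum {ι : Type*} (T : ℕ) (s : Finset ι) (g : ι → (ℕ → α) → ℝ) :
    avg T (fun v => ∑ i ∈ s, g i v) = ∑ i ∈ s, avg T (g i) := by
  classical
  induction s using Finset.induction_on with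
  | empty => simp [avg_const]
  | insert a s ha ih => simp [Finset.sum_insert ha, avg_add, ih]

lemma abs_avg_le (T : ℕ) (g : (ℕ → α) → ℝ) : |avg T g| ≤ avg T fun v => |g v| := by
  rw [abs_le]
  constructor
  · have := avg_const_mul T (-1) fun v => |g v|
    rw [← neg_one_mul, ← this]
    exact avg_mono fun v => by linarith [neg_abs_le (g v)]
  · exact avg_mono fun v => le_abs_self _

lemma avg_succ_eq_of_dependsOn {T : ℕ} {g : (ℕ → α) → ℝ} (hg : DependsOn g (Set.Iio T)) :
    avg (T + 1) g = avg T g := by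
  have h : ∀ a, (fun v => g (Function.update v T a)) = g := fun a => by
    funext v
    exact hg fun s hs => Function.update_of_ne (ne_of_lt hs) _ _
  simp [avg, h]

/-- The entry at `t` is uniform and independent of the earlier entries. -/
lemma avg_apply_mul {t T : ℕ} (htT : t < T) (c : α → ℝ) {g : (ℕ → α) → ℝ}
    (hg : DependsOn g (Set.Iio t)) :
    avg T (fun v => c (v t) * g v) = (∑ a, c a) / Fintype.card α * avg T g := by
  induction T, htT using Nat.le_induction with
  | base =>
    have h : ∀ (a : α) (v : ℕ → α), g (Function.update v t a) = g v := fun a v =>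
      hg fun s hs => Function.update_of_ne (ne_of_lt hs) _ _
    rw [avg_succ_eq_of_dependsOn hg]
    simp [avg, h, avg_const_mul, ← Finset.sum_mul]
    ring
  | succ T htT ih =>
    rw [avg_succ_eq_of_dependsOn (g := g) fun v v' h => hg fun s hs =>
      h s (lt_trans hs (Nat.lt_of_succ_le htT)), ← ih]
    refine avg_succ_eq_of_dependsOn fun v v' h => ?_
    rw [h t (Nat.lt_of_succ_le htT), hg fun s hs => h s (lt_trans hs (Nat.lt_of_succ_le htT))]

lemma avg_prod (T : ℕ) (g : (ℕ → α × β) → ℝ) :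
    avg T g = avg T fun v => avg T fun b => g fun s => (v s, b s) := by
  induction T generalizing g with
  | zero => rfl
  | succ T ih =>
    have h : ∀ (v : ℕ → α) (b : ℕ → β) (a : α) (c : β),
        Function.update (fun s => (v s, b s)) T (a, c) =
          fun s => (Function.update v T a s, Function.update b T c s) := fun v b a c => by
      funext s
      by_cases hs : s = T
      · subst hs; simp
      · simp [Function.update_of_ne hs]
    simp only [avg, ih, h, Fintype.sum_prod_type, Fintype.card_prod, Nat.cast_mul, div_eq_inv_mul,
      avg_const_mul, avg_sum, Finset.mul_sum, mul_inv]
    simp only [mul_assoc]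

/-- Forcing the fair bits at the positions in `S` to be `true` costs `2 ^ |S|`. -/
lemma avg_forall_eq_true {T : ℕ} {S : Finset ℕ} (hS : ∀ s ∈ S, s < T) :
    avg T (fun b : ℕ → Bool => if ∀ s ∈ S, b s = true then (1 : ℝ) else 0) =
      (1 / 2) ^ S.card := by
  induction T generalizing S with
  | zero =>
    have : S = ∅ := Finset.eq_empty_of_forall_notMem fun s hs => by simpa using hS s hs
    simp [this, avg]
  | succ T ih =>
    have hlt : ∀ s ∈ S.erase T, s < T := fun s hs => by
      have := hS s (Finset.mem_of_mem_erase hs)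
      have := Finset.ne_of_mem_erase hs
      omega
    by_cases hT : T ∈ S
    · have h1 : ∀ b : ℕ → Bool,
          (∀ s ∈ S, Function.update b T true s = true) ↔ ∀ s ∈ S.erase T, b s = true := by
        intro b
        constructor
        · intro h s hs
          simpa [Function.update_of_ne (Finset.ne_of_mem_erase hs)] using
            h s (Finset.mem_of_mem_erase hs)
        · intro h s hs
          by_cases hsT : s = T
          · simp [hsT]
          · simpa [Function.update_of_ne hsT] using h s (Finset.mem_erase.2 ⟨hsT, hs⟩)
      have h0 : ∀ b : ℕ → Bool, ¬ ∀ s ∈ S, Function.update b T false s = true := fun b h => by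
        simpa using h T hT
      simp only [avg, Fintype.sum_bool, h1, h0, if_false, ih hlt, avg_const, Fintype.card_bool]
      rw [← Finset.card_erase_add_one hT, pow_succ]
      push_cast
      ring
    · rw [avg_succ_eq_of_dependsOn]
      · exact ih (by rwa [Finset.erase_eq_of_notMem hT] at hlt)
      · intro b b' h
        have : (∀ s ∈ S, b s = true) ↔ ∀ s ∈ S, b' s = true := by
          refine forall₂_congr fun s hs => ?_
          rw [h s (by rw [Finset.erase_eq_of_notMem hT] at hlt; exact hlt s hs)]
        simp [this]

/-- Union bound. -/
lemma avg_exists_le {ι : Type*} (T : ℕ) (s : Finset ι) (p : ι → (ℕ → α) → Prop)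
    [∀ i v, Decidable (p i v)] [∀ v, Decidable (∃ i ∈ s, p i v)] :
    avg T (fun v => if ∃ i ∈ s, p i v then (1 : ℝ) else 0) ≤
      ∑ i ∈ s, avg T fun v => if p i v then (1 : ℝ) else 0 := by
  rw [← avg_sum]
  refine avg_mono fun v => ?_
  split_ifs with h
  · obtain ⟨i, hi, hp⟩ := h
    refine le_trans ?_ (Finset.single_le_sum (f := fun i => if p i v then (1 : ℝ) else 0)
      (fun _ _ => by split_ifs <;> norm_num) hi)
    simp [hp]
  · exact Finset.sum_nonneg fun _ _ => by split_ifs <;> norm_num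

/-- The probability that a given value is missed throughout a window. -/
lemma avg_forall_ne [DecidableEq α] (u : α) {a b T : ℕ} (hab : a ≤ b) (hbT : b ≤ T) :
    avg T (fun v => if ∀ s, a ≤ s → s < b → v s ≠ u then (1 : ℝ) else 0) =
      (1 - 1 / Fintype.card α) ^ (b - a) := by
  induction b, hab using Nat.le_induction with
  | base =>
    have : ∀ v : ℕ → α, ∀ s, a ≤ s → s < a → v s ≠ u := fun v s h1 h2 => by omega
    simp only [if_pos (this _), avg_const, Nat.sub_self, pow_zero]
  | succ b hab ih =>
    have h : ∀ v : ℕ → α, (if ∀ s, a ≤ s → s < b + 1 → v s ≠ u then (1 : ℝ) else 0) =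
        (fun x => if x = u then (0 : ℝ) else 1) (v b) *
          if ∀ s, a ≤ s → s < b → v s ≠ u then (1 : ℝ) else 0 := fun v => by
      by_cases hb : v b = u
      · have : ¬ ∀ s, a ≤ s → s < b + 1 → v s ≠ u := fun h => h b hab (by omega) hb
        simp only [if_neg this, if_pos hb, zero_mul]
      · have : (∀ s, a ≤ s → s < b + 1 → v s ≠ u) ↔ ∀ s, a ≤ s → s < b → v s ≠ u :=
          ⟨fun h s h1 h2 => h s h1 (by omega), fun h s h1 h2 => by
            rcases Nat.lt_succ_iff_lt_or_eq.1 h2 with h2 | rfl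
            exacts [h s h1 h2, hb]⟩
        simp only [this, if_neg hb, one_mul]
    simp only [h]
    rw [avg_apply_mul (t := b) (by omega) (fun x => if x = u then (0 : ℝ) else 1),
      ih (by omega), Nat.succ_sub hab, pow_succ, mul_comm]
    · congr 1
      have hc : (Fintype.card α : ℝ) ≠ 0 := by simp
      have : ∑ x : α, (if x = u then (0 : ℝ) else 1) = Fintype.card α - 1 := by
        have h2 : ∀ x : α, (if x = u then (0 : ℝ) else 1) = 1 - if x = u then 1 else 0 :=
          fun x => by split_ifs <;> simp
        simp [h2]
      rw [this]
      field_simp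
    · intro v v' hv
      have : (∀ s, a ≤ s → s < b → v s ≠ u) ↔ ∀ s, a ≤ s → s < b → v' s ≠ u :=
        forall₃_congr fun s _ h2 => by rw [hv s h2]
      simp [this]

end Average

/-! ### Backward searches along an update sequence -/

section Search

variable {V : Type*} [Fintype V]

variable (V) in
/-- The factor by which a witness is weighted for every unit of time that it spans. It is small
enough that a backward search for a given vertex keeps a bounded expected weight, and large enough
that `n log n` steps are weighted by a large power of `n`. -/
def tilt : ℝ := 1 + 1 / (4 * Fintype.card V)

lemma one_le_tilt : 1 ≤ tilt V := by
  unfold tilt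
  have : (0 : ℝ) ≤ 1 / (4 * Fintype.card V) := by positivity
  linarith

lemma tilt_pos : 0 < tilt V := zero_lt_one.trans_le one_le_tilt

lemma two_pow_le_tilt_pow [Nonempty V] (m : ℕ) :
    (2 : ℝ) ^ m ≤ tilt V ^ (4 * Fintype.card V * m) := by
  rw [pow_mul]
  refine pow_le_pow_left₀ (by norm_num) ?_ _
  have hn : (0 : ℝ) < Fintype.card V := by exact_mod_cast Fintype.card_pos
  have h := one_add_mul_le_pow (a := 1 / (4 * (Fintype.card V : ℝ)))
    (by have : (0 : ℝ) ≤ 1 / (4 * Fintype.card V) := by positivity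
        linarith) (4 * Fintype.card V)
  refine le_trans (le_of_eq ?_) h
  push_cast
  field_simp
  norm_num

variable [DecidableEq V]

/-- The total weight, over all times `s < t` at which a vertex of `p` is updated while `w` is not
updated strictly between `s` and `t`, of `tilt V ^ (t - s) * φ s` (see `search_eq_sum`). -/
def search (w : V) (p : Finset V) (φ : ℕ → ℝ) (v : ℕ → V) : ℕ → ℝ
  | 0 => 0
  | t + 1 => tilt V *
      ((if v t ∈ p then φ t else 0) + if v t = w then 0 else search w p φ v t)

open Classical in
lemma search_eq_sum (w : V) (p : Finset V) (φ : ℕ → ℝ) (v : ℕ → V) (t : ℕ) :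
    search w p φ v t = ∑ s ∈ Finset.range t,
      if v s ∈ p ∧ ∀ τ, s < τ → τ < t → v τ ≠ w then tilt V ^ (t - s) * φ s else 0 := by
  induction t with
  | zero => rfl
  | succ t ih =>
    rw [Finset.sum_range_succ, search, ih, add_comm (ite _ _ _), mul_add]
    congr 1
    · split_ifs with hw
      · rw [mul_zero]
        refine (Finset.sum_eq_zero fun s hs => if_neg fun h => ?_).symm
        exact h.2 t (Finset.mem_range.1 hs) (Nat.lt_succ_self t) hw
      · rw [Finset.mul_sum]
        refine Finset.sum_congr rfl fun s hs => ?_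
        have hst := Finset.mem_range.1 hs
        have : (∀ τ, s < τ → τ < t + 1 → v τ ≠ w) ↔ ∀ τ, s < τ → τ < t → v τ ≠ w :=
          ⟨fun h τ h1 h2 => h τ h1 (by omega), fun h τ h1 h2 => by
            rcases Nat.lt_succ_iff_lt_or_eq.1 h2 with h2 | rfl
            exacts [h τ h1 h2, hw]⟩
        rw [this, mul_ite, mul_zero, ← mul_assoc, ← pow_succ', ← Nat.sub_add_comm hst.le]
    · have : ∀ τ, t < τ → τ < t + 1 → v τ ≠ w := fun τ h1 h2 => by omega
      simp only [and_iff_left this, mul_ite, mul_zero]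
      simp

lemma dependsOn_search (w : V) (p : Finset V) {φ : (ℕ → V) → ℕ → ℝ}
    (hφ : ∀ s, DependsOn (fun v => φ v s) (Set.Iio s)) (t : ℕ) :
    DependsOn (fun v => search w p (φ v) v t) (Set.Iio t) := by
  induction t with
  | zero => exact fun _ _ _ => rfl
  | succ t ih =>
    intro v v' h
    have h' : ∀ s ∈ Set.Iio t, v s = v' s := fun s hs => h s (lt_trans hs (Nat.lt_succ_self t))
    have h1 := ih h'
    have h2 := hφ t h'
    dsimp only at h1 h2
    simp only [search, h1, h2, h t (Nat.lt_succ_self t)]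

/-- A backward search for an update of a vertex of `p`, guarded by one vertex, multiplies the
expected weight by at most `3 / 2 * |p|`: going back one step, the search ends with probability
`|p| / n` and is cut off by the guard with probability `1 / n`. -/
lemma avg_search_le [Inhabited V] (w : V) (p : Finset V) {φ : (ℕ → V) → ℕ → ℝ} {T : ℕ} {B : ℝ}
    (hdep : ∀ s, DependsOn (fun v => φ v s) (Set.Iio s)) (hB : 0 ≤ B)
    (hφB : ∀ s < T, avg T (fun v => φ v s) ≤ B) {t : ℕ} (ht : t ≤ T) :
    avg T (fun v => search w p (φ v) v t) ≤ 3 / 2 * p.card * B := by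
  induction t with
  | zero =>
    simp only [search, avg_const]
    positivity
  | succ t ih =>
    have h : ∀ v : ℕ → V, search w p (φ v) v (t + 1) =
        tilt V * ((fun x => if x ∈ p then (1 : ℝ) else 0) (v t) * φ v t +
          (fun x => if x = w then (0 : ℝ) else 1) (v t) * search w p (φ v) v t) := fun v => by
      simp [search]
    have hn : (1 : ℝ) ≤ Fintype.card V := by exact_mod_cast Fintype.card_pos
    have hw : ∑ x : V, (if x = w then (0 : ℝ) else 1) = Fintype.card V - 1 := by
      have h2 : ∀ x : V, (if x = w then (0 : ℝ) else 1) = 1 - if x = w then 1 else 0 :=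
        fun x => by split_ifs <;> simp
      simp [h2]
    have hp : ∑ x : V, (if x ∈ p then (1 : ℝ) else 0) = p.card := by simp
    simp only [h]
    rw [avg_const_mul, avg_add,
      avg_apply_mul (t := t) ht (fun x => if x ∈ p then (1 : ℝ) else 0) (hdep t),
      avg_apply_mul (t := t) ht (fun x => if x = w then (0 : ℝ) else 1)
        (dependsOn_search w p hdep t), hw, hp]
    have h1 := hφB t ht
    have h2 := ih (by omega)
    set n : ℝ := (Fintype.card V : ℝ)
    calc tilt V * (p.card / n * avg T (fun v => φ v t) +
          (n - 1) / n * avg T (fun v => search w p (φ v) v t))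
        ≤ tilt V * (p.card / n * B + (n - 1) / n * (3 / 2 * p.card * B)) := by
          have : 0 ≤ (n - 1) / n := div_nonneg (by linarith) (by linarith)
          have := tilt_pos (V := V)
          gcongr
      _ = p.card * B * ((1 + 1 / (4 * n)) * (1 / n + (n - 1) / n * (3 / 2))) := by
          unfold tilt; ring
      _ ≤ p.card * B * (3 / 2) := by
          gcongr
          have : (1 + 1 / (4 * n)) * (1 / n + (n - 1) / n * (3 / 2)) =
              (12 * n ^ 2 - n - 1) / (8 * n ^ 2) := by
            field_simp
            ring
          rw [this, div_le_iff₀ (by positivity)]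
          linarith
      _ = 3 / 2 * p.card * B := by ring

end Search

/-! ### Chains of hyperedges in space-time -/

section Chains

variable {V : Type*} [DecidableEq V]

lemma exists_last_update {v : ℕ → V} {w : V} {t : ℕ} (h : ∃ s < t, v s = w) :
    ∃ s < t, v s = w ∧ ∀ τ, s < τ → τ < t → v τ ≠ w := by
  induction t with
  | zero => obtain ⟨s, hs, -⟩ := h; omega
  | succ t ih =>
    by_cases hw : v t = w
    · exact ⟨t, by omega, hw, fun τ h1 h2 => by omega⟩
    · obtain ⟨s, hs, hsw⟩ := h
      have hst : s < t := by
        rcases Nat.lt_succ_iff_lt_or_eq.1 hs with h | rfl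
        exacts [h, absurd hsw hw]
      obtain ⟨r, hr, hrw, hr'⟩ := ih ⟨s, hst, hsw⟩
      refine ⟨r, by omega, hrw, fun τ h1 h2 => ?_⟩
      rcases Nat.lt_succ_iff_lt_or_eq.1 h2 with h2 | rfl
      exacts [hr' τ h1 h2, hw]

/-- Every vertex is updated in the time window `[a, b)`. -/
def Covers (v : ℕ → V) (a b : ℕ) : Prop := ∀ u, ∃ s, a ≤ s ∧ s < b ∧ v s = u

open Classical in
/-- For a node `x = (e, t)`, consisting of a hyperedge and a time, the times of the most recent
updates (up to and including time `t`) of the vertices of `e`. -/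
def recent (v : ℕ → V) (x : Finset V × ℕ) : Finset ℕ :=
  (Finset.range (x.2 + 1)).filter fun s => v s ∈ x.1 ∧ ∀ τ, s < τ → τ ≤ x.2 → v τ ≠ v s

lemma mem_recent {v : ℕ → V} {x : Finset V × ℕ} {s : ℕ} :
    s ∈ recent v x ↔ s ≤ x.2 ∧ v s ∈ x.1 ∧ ∀ τ, s < τ → τ ≤ x.2 → v τ ≠ v s := by
  simp [recent]

lemma card_le_card_recent {v : ℕ → V} {x : Finset V × ℕ} {a : ℕ} (h : Covers v 0 a)
    (hx : a ≤ x.2) : x.1.card ≤ (recent v x).card := by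
  refine (Finset.card_le_card fun w hw => ?_).trans (Finset.card_image_le (f := v))
  obtain ⟨s, -, hs, hsw⟩ := h w
  obtain ⟨r, hr, hrw, hr'⟩ := exists_last_update (t := x.2 + 1) ⟨s, by omega, hsw⟩
  exact Finset.mem_image.2 ⟨r, mem_recent.2 ⟨by omega, hrw ▸ hw, fun τ h1 h2 => hrw ▸
    hr' τ h1 (by omega)⟩, hrw⟩

/-- The times of all most recent updates along a list of nodes. -/
def bits (v : ℕ → V) : List (Finset V × ℕ) → Finset ℕ
  | [] => ∅
  | x :: l => recent v x ∪ bits v l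

lemma mem_bits {v : ℕ → V} {l : List (Finset V × ℕ)} {s : ℕ} :
    s ∈ bits v l ↔ ∃ x ∈ l, s ∈ recent v x := by
  induction l with
  | nil => simp [bits]
  | cons x l ih => simp [bits, ih]

/-- Nodes that are not consecutive in the list share no most recent update. -/
def Separated (v : ℕ → V) : List (Finset V × ℕ) → Prop
  | x :: y :: l => (∀ z ∈ l, Disjoint (recent v x) (recent v z)) ∧ Separated v (y :: l)
  | _ => True

/-- The time of the last node of the nonempty list `x :: l`. -/
def endTime : Finset V × ℕ → List (Finset V × ℕ) → ℕ
  | x, [] => x.2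
  | _, y :: l => endTime y l

omit [DecidableEq V] in
lemma endTime_append_cons (x y : Finset V × ℕ) (l₁ l₂ : List (Finset V × ℕ)) :
    endTime x (l₁ ++ y :: l₂) = endTime y l₂ := by
  induction l₁ generalizing x with
  | nil => rfl
  | cons z l ih => exact ih z

/-- One step back in time along a discrepancy: the vertex updated at `y` lies in both hyperedges,
and it is not updated again until the time of `x`. -/
def Linked (v : ℕ → V) (x y : Finset V × ℕ) : Prop :=
  y.2 < x.2 ∧ y.2 ∈ recent v x ∧ v y.2 ∈ y.1

/-- A step back in time between hyperedges which have a common vertex that is not updated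
strictly between the two nodes. -/
def Jump (v : ℕ → V) (x y : Finset V × ℕ) : Prop :=
  y.2 < x.2 ∧ v y.2 ∈ y.1 ∧ ∃ w ∈ x.1, w ∈ y.1 ∧ ∀ τ, y.2 < τ → τ < x.2 → v τ ≠ w

/-- A step back in time that passes over an update, at time `s`, of the hyperedge of `x`: some
vertex of this hyperedge is not updated between `s` and `x`, and the vertex updated at `y`, which
lies in both hyperedges, is not updated again until `s`. -/
def Hop (v : ℕ → V) (x y : Finset V × ℕ) : Prop :=
  ∃ s, y.2 < s ∧ s < x.2 ∧ v s ∈ x.1 ∧ (∃ w ∈ x.1, ∀ τ, s < τ → τ < x.2 → v τ ≠ w) ∧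
    v y.2 ∈ x.1 ∧ v y.2 ∈ y.1 ∧ ∀ τ, y.2 < τ → τ < s → v τ ≠ v y.2

lemma Linked.not_disjoint {v : ℕ → V} {x y : Finset V × ℕ} (h : Linked v x y) :
    ¬ Disjoint (recent v x) (recent v y) :=
  Finset.not_disjoint_iff.2
    ⟨y.2, h.2.1, mem_recent.2 ⟨le_rfl, h.2.2, fun τ h1 h2 => by omega⟩⟩

lemma exists_guard {v : ℕ → V} {x y : Finset V × ℕ} (h : ¬ Disjoint (recent v x) (recent v y)) :
    ∃ w ∈ x.1, w ∈ y.1 ∧ ∀ τ, y.2 < τ → τ ≤ x.2 → v τ ≠ w := by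
  obtain ⟨s, hx, hy⟩ := Finset.not_disjoint_iff.1 h
  rw [mem_recent] at hx hy
  exact ⟨v s, hx.2.1, hy.2.1, fun τ h1 h2 => hx.2.2 τ (by omega) h2⟩

lemma jump_of_not_disjoint {v : ℕ → V} {x y : Finset V × ℕ} (hyx : y.2 < x.2) (hy : v y.2 ∈ y.1)
    (h : ¬ Disjoint (recent v x) (recent v y)) : Jump v x y := by
  obtain ⟨w, hx, hwy, hw⟩ := exists_guard h
  exact ⟨hyx, hy, w, hx, hwy, fun τ h1 h2 => hw τ h1 h2.le⟩

lemma lt_and_mem_of_isChain_linked {v : ℕ → V} {x : Finset V × ℕ} {l : List (Finset V × ℕ)}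
    (h : List.IsChain (Linked v) (x :: l)) : ∀ y ∈ l, y.2 < x.2 ∧ v y.2 ∈ y.1 := by
  induction l generalizing x with
  | nil => simp
  | cons z l ih =>
    rw [List.isChain_cons_cons] at h
    intro y hy
    rcases List.mem_cons.1 hy with rfl | hy
    · exact ⟨h.1.1, h.1.2.2⟩
    · exact ⟨(ih h.2 y hy).1.trans h.1.1, (ih h.2 y hy).2⟩

/-- Splitting a list at the last element with a given property. -/
lemma exists_eq_append_cons_of_mem {α : Type*} {p : α → Prop} {l : List α} (h : ∃ y ∈ l, p y) :
    ∃ l₁ y l₂, l = l₁ ++ y :: l₂ ∧ p y ∧ ∀ z ∈ l₂, ¬ p z := by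
  induction l with
  | nil => simp at h
  | cons a l ih =>
    by_cases hl : ∃ y ∈ l, p y
    · obtain ⟨l₁, y, l₂, rfl, hy, hl₂⟩ := ih hl
      exact ⟨a :: l₁, y, l₂, rfl, hy, hl₂⟩
    · obtain ⟨y, hy, hpy⟩ := h
      rcases List.mem_cons.1 hy with rfl | hy
      · exact ⟨[], y, l, rfl, hpy, fun z hz hpz => hl ⟨z, hz, hpz⟩⟩
      · exact absurd ⟨y, hy, hpy⟩ hl

/-- In a chain, the last node which shares a most recent update with the first one. -/
lemma exists_last_not_disjoint {v : ℕ → V} {x y : Finset V × ℕ} {l : List (Finset V × ℕ)}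
    (h : List.IsChain (Linked v) (x :: y :: l)) :
    ∃ l₁ z l₂, y :: l = l₁ ++ z :: l₂ ∧ ¬ Disjoint (recent v x) (recent v z) ∧
      (∀ u ∈ l₂, Disjoint (recent v x) (recent v u)) ∧ z.2 < x.2 ∧ v z.2 ∈ z.1 ∧
      List.IsChain (Linked v) (z :: l₂) := by
  obtain ⟨l₁, z, l₂, hl, hz, hl₂⟩ := exists_eq_append_cons_of_mem (l := y :: l)
    (p := fun u => ¬ Disjoint (recent v x) (recent v u))
    ⟨y, List.mem_cons_self, (List.isChain_cons_cons.1 h).1.not_disjoint⟩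
  have hzl : z ∈ y :: l := by rw [hl]; simp
  obtain ⟨h1, h2⟩ := lt_and_mem_of_isChain_linked h z hzl
  refine ⟨l₁, z, l₂, hl, hz, fun u hu => not_not.1 (hl₂ u hu), h1, h2, ?_⟩
  rw [hl] at h
  exact h.suffix ⟨x :: l₁, by simp⟩

/-- Jumping each time to the last node that shares a most recent update with the current one
leads to a separated chain. -/
lemma exists_separated_jump_chain {v : ℕ → V} (l : List (Finset V × ℕ)) (x : Finset V × ℕ)
    (h : List.IsChain (Linked v) (x :: l)) :
    ∃ l', l' ⊆ l ∧ List.IsChain (Jump v) (x :: l') ∧ endTime x l' = endTime x l ∧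
      Separated v (x :: l') := by
  induction hn : l.length using Nat.strong_induction_on generalizing l x with
  | _ n ih =>
    cases l with
    | nil => exact ⟨[], List.Subset.refl _, List.isChain_singleton _, rfl, trivial⟩
    | cons y l =>
      obtain ⟨l₁, z, l₂, hl, hz, hl₂, hzx, hvz, hc⟩ := exists_last_not_disjoint h
      have hlen : l₂.length < n := by rw [← hn, hl]; simp; omega
      obtain ⟨l', hl', hch, hend, hsep⟩ := ih _ hlen l₂ z hc rfl
      refine ⟨z :: l', ?_, ?_, ?_, fun u hu => hl₂ u (hl' hu), hsep⟩
      · rw [hl]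
        exact List.cons_subset.2 ⟨by simp, fun u hu => by simp [hl' hu]⟩
      · exact List.isChain_cons_cons.2 ⟨jump_of_not_disjoint hzx hvz hz, hch⟩
      · rw [hl, endTime_append_cons]
        exact hend

lemma mul_length_le_two_mul_card_bits {v : ℕ → V} {k : ℕ} (l : List (Finset V × ℕ))
    (hk : ∀ x ∈ l, k ≤ (recent v x).card) (h : Separated v l) :
    k * l.length ≤ 2 * (bits v l).card := by
  induction hn : l.length using Nat.strong_induction_on generalizing l with
  | _ n ih =>
    match l, hk, h with
    | [], _, _ => simp at hn; simp [← hn]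
    | [x], hk, _ =>
      have := hk x (by simp)
      simp only [List.length_cons, List.length_nil] at hn
      subst hn
      simp only [bits, Finset.union_empty]
      omega
    | x :: y :: l, hk, h =>
      have hl : Separated v l := by
        have := h.2
        cases l with
        | nil => trivial
        | cons z l => exact this.2
      simp only [List.length_cons] at hn
      have h1 := ih l.length (by omega) l (fun z hz => hk z (by simp [hz])) hl rfl
      have hdisj : Disjoint (recent v x) (bits v l) := Finset.disjoint_left.2 fun s hs hs' => by
        obtain ⟨z, hz, hsz⟩ := mem_bits.1 hs'
        exact Finset.disjoint_left.1 (h.1 z hz) hs hsz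
      have h2 : (recent v x).card + (bits v l).card ≤ (bits v (x :: y :: l)).card := by
        rw [← Finset.card_union_of_disjoint hdisj]
        refine Finset.card_le_card (Finset.union_subset_union_right ?_)
        exact Finset.subset_union_right
      have := hk x (by simp)
      subst hn
      calc k * (l.length + 1 + 1) = k * l.length + 2 * k := by ring
        _ ≤ 2 * (bits v l).card + 2 * (recent v x).card := by omega
        _ ≤ _ := by omega

/-- In the linear case, two nodes with different hyperedges share at most one update. -/
lemma card_recent_inter_le_one {v : ℕ → V} {x y : Finset V × ℕ} (h : (x.1 ∩ y.1).card ≤ 1) :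
    (recent v x ∩ recent v y).card ≤ 1 := by
  refine Finset.card_le_one.2 fun s hs r hr => ?_
  rw [Finset.mem_inter, mem_recent, mem_recent] at hs hr
  have heq : v s = v r := Finset.card_le_one.1 h _ (Finset.mem_inter.2 ⟨hs.1.2.1, hs.2.2.1⟩) _
    (Finset.mem_inter.2 ⟨hr.1.2.1, hr.2.2.1⟩)
  rcases lt_trichotomy s r with hlt | rfl | hlt
  · exact absurd heq.symm (hs.1.2.2 r hlt hr.1.1)
  · rfl
  · exact absurd heq (hr.1.2.2 s hlt hs.1.1)

/-- In the linear case one moves to the last node that shares a most recent update with the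
current one, unless it has the same hyperedge, in which case one moves to its successor. Then
consecutive nodes share at most one update. If there is no such successor, the current
node is already close to the end of the chain, because some vertex is not updated in between. -/
lemma exists_separated_hop_chain {v : ℕ → V} {𝓔 : Finset (Finset V)} {b c : ℕ}
    (hlin : ∀ e ∈ 𝓔, ∀ f ∈ 𝓔, e ≠ f → (e ∩ f).card ≤ 1) (hbc : Covers v b c)
    (l : List (Finset V × ℕ)) (x : Finset V × ℕ) (h : List.IsChain (Linked v) (x :: l))
    (hE : ∀ y ∈ x :: l, y.1 ∈ 𝓔) (hend : endTime x l < b) (hb : b ≤ c) :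
    ∃ l', l' ⊆ l ∧ List.IsChain (fun x y => Jump v x y ∨ Hop v x y) (x :: l') ∧
      endTime x l' < c ∧ Separated v (x :: l') ∧
      List.IsChain (fun x y => (recent v x ∩ recent v y).card ≤ 1) (x :: l') := by
  induction hn : l.length using Nat.strong_induction_on generalizing l x with
  | _ n ih =>
    cases l with
    | nil => exact ⟨[], List.Subset.refl _, List.isChain_singleton _,
        lt_of_lt_of_le hend hb, trivial, List.isChain_singleton _⟩
    | cons y l =>
      obtain ⟨l₁, z, l₂, hl, hz, hl₂, hzx, hvz, hc⟩ := exists_last_not_disjoint h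
      have hlen : l₂.length < n := by rw [← hn, hl]; simp; omega
      rw [hl, endTime_append_cons] at hend
      rw [hl] at hE ⊢
      by_cases hxz : x.1 = z.1
      · cases l₂ with
        | nil =>
          refine ⟨[], by simp, List.isChain_singleton _, ?_, trivial, List.isChain_singleton _⟩
          obtain ⟨w, -, -, hw⟩ := exists_guard hz
          obtain ⟨s, hbs, hsc, hsw⟩ := hbc w
          change z.2 < b at hend
          change x.2 < c
          by_contra hxc
          exact hw s (by omega) (by omega) hsw
        | cons u l₂ =>
          rw [List.isChain_cons_cons] at hc
          rw [List.length_cons] at hlen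
          obtain ⟨l', hl', hch, hend', hsep, hone⟩ := ih l₂.length (by omega) l₂ u hc.2
            (fun y hy => hE y (by simp only [List.mem_cons, List.mem_append] at hy ⊢; tauto))
            hend rfl
          refine ⟨u :: l', ?_, ?_, hend', ⟨fun y hy => hl₂ y (by simp [hl' hy]), hsep⟩, ?_⟩
          · exact List.cons_subset.2 ⟨by simp, fun y hy => by simp [hl' hy]⟩
          · refine List.isChain_cons_cons.2 ⟨Or.inr ?_, hch⟩
            obtain ⟨w, hwx, -, hw⟩ := exists_guard hz
            obtain ⟨huz, hur, huu⟩ := hc.1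
            rw [mem_recent] at hur
            exact ⟨z.2, huz, hzx, hxz ▸ hvz, ⟨w, hwx, fun τ h1 h2 => hw τ h1 h2.le⟩,
              hxz ▸ hur.2.1, huu, fun τ h1 h2 => hur.2.2 τ h1 h2.le⟩
          · refine List.isChain_cons_cons.2 ⟨?_, hone⟩
            rw [Finset.disjoint_iff_inter_eq_empty.1 (hl₂ u (by simp))]
            simp
      · obtain ⟨l', hl', hch, hend', hsep, hone⟩ := ih _ hlen l₂ z hc
          (fun y hy => hE y (by simp only [List.mem_cons, List.mem_append] at hy ⊢; tauto))
          hend rfl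
        refine ⟨z :: l', ?_, ?_, hend', ⟨fun u hu => hl₂ u (hl' hu), hsep⟩, ?_⟩
        · exact List.cons_subset.2 ⟨by simp, fun u hu => by simp [hl' hu]⟩
        · exact List.isChain_cons_cons.2 ⟨Or.inl (jump_of_not_disjoint hzx hvz hz), hch⟩
        · exact List.isChain_cons_cons.2 ⟨card_recent_inter_le_one
            (hlin _ (hE x (by simp)) _ (hE z (by simp)) hxz), hone⟩

lemma mul_length_le_card_bits_add {v : ℕ → V} {k : ℕ} (l : List (Finset V × ℕ))
    (hk : ∀ x ∈ l, k ≤ (recent v x).card) (h : Separated v l)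
    (hone : List.IsChain (fun x y => (recent v x ∩ recent v y).card ≤ 1) l) :
    k * l.length ≤ (bits v l).card + l.length := by
  induction l with
  | nil => simp
  | cons x l ih =>
    have hx := hk x (by simp)
    have hk' : ∀ y ∈ l, k ≤ (recent v y).card := fun y hy => hk y (by simp [hy])
    have hinter : (recent v x ∩ bits v l).card ≤ 1 ∧ k * l.length ≤ (bits v l).card + l.length := by
      cases l with
      | nil => simp [bits]
      | cons y l =>
        rw [List.isChain_cons_cons] at hone
        refine ⟨le_trans (Finset.card_le_card fun s hs => ?_) hone.1, ih hk' h.2 hone.2⟩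
        rw [Finset.mem_inter, mem_bits] at hs
        obtain ⟨hs, z, hz, hsz⟩ := hs
        rcases List.mem_cons.1 hz with rfl | hz
        · exact Finset.mem_inter.2 ⟨hs, hsz⟩
        · exact absurd hsz (Finset.disjoint_left.1 (h.1 z hz) hs)
    have := Finset.card_union_add_card_inter (recent v x) (bits v l)
    rw [List.length_cons, mul_add, mul_one]
    simp only [bits]
    omega

end Chains

/-! ### Tracing discrepancies back in time -/

section Dynamics

variable {V : Type*} [DecidableEq V]

/-- The set `I` contains no set from the family `𝓔` of hyperedges. -/
def Indep (𝓔 : Finset (Finset V)) (I : Finset V) : Prop := ∀ e ∈ 𝓔, ¬ e ⊆ I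

open Classical in
/-- The update of `I` at the vertex `w` with random bit `c`. -/
def update (𝓔 : Finset (Finset V)) (w : V) (c : Bool) (I : Finset V) : Finset V :=
  if c then (if Indep 𝓔 (insert w I) then insert w I else I) else I.erase w

/-- The state at time `t` of the dynamics started from `I` and driven by the vertices `v` and the
bits `b`. -/
def run (𝓔 : Finset (Finset V)) (v : ℕ → V) (b : ℕ → Bool) (I : Finset V) : ℕ → Finset V
  | 0 => I
  | t + 1 => update 𝓔 (v t) (b t) (run 𝓔 v b I t)

variable {𝓔 : Finset (Finset V)} {v : ℕ → V} {b : ℕ → Bool} {I J : Finset V}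

lemma indep_run (hI : Indep 𝓔 I) (t : ℕ) : Indep 𝓔 (run 𝓔 v b I t) := by
  induction t with
  | zero => exact hI
  | succ t ih =>
    simp only [run, update]
    split_ifs with h1 h2
    · exact h2
    · exact ih
    · exact fun e he h => ih e he (h.trans (Finset.erase_subset _ _))

lemma mem_update_of_ne {w u : V} (h : u ≠ w) (c : Bool) :
    u ∈ update 𝓔 w c I ↔ u ∈ I := by
  simp only [update]
  split_ifs <;> simp [h]

lemma mem_run_iff_of_not_updated {w : V} {s t : ℕ} (hst : s ≤ t)
    (h : ∀ τ, s ≤ τ → τ < t → v τ ≠ w) : w ∈ run 𝓔 v b I t ↔ w ∈ run 𝓔 v b I s := by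
  induction t, hst using Nat.le_induction with
  | base => rfl
  | succ t hst ih =>
    rw [run, mem_update_of_ne (h t hst (by omega)).symm]
    exact ih fun τ h1 h2 => h τ h1 (by omega)

lemma mem_update_self (hI : Indep 𝓔 I) (w : V) (c : Bool) :
    w ∈ update 𝓔 w c I ↔ c = true ∧ Indep 𝓔 (insert w I) := by
  simp only [update]
  split_ifs with h1 h2
  · simp [h1, h2]
  · simp only [h1, h2, and_false, iff_false]
    exact fun hw => h2 (by rwa [Finset.insert_eq_of_mem hw])
  · simp [h1]

/-- A vertex that is occupied before time `t` was set to `1` by its last update before `t`. -/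
lemma bit_eq_true_of_mem (hI : Indep 𝓔 I) {s t : ℕ} (hst : s < t)
    (h : ∀ τ, s < τ → τ < t → v τ ≠ v s) (hmem : v s ∈ run 𝓔 v b I t) : b s = true := by
  rw [mem_run_iff_of_not_updated (s := s + 1) hst fun τ h1 h2 => h τ (by omega) h2, run,
    mem_update_self (indep_run hI s)] at hmem
  exact hmem.1

/-- If only the first of two states admits the insertion of `w`, some hyperedge at `w` blocks the
second one; this hyperedge contains a discrepancy, and it is occupied except at `w`. -/
lemma exists_blocking_edge (hJ : Indep 𝓔 J) {s : ℕ}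
    (h1 : Indep 𝓔 (insert (v s) (run 𝓔 v b I s))) (h2 : ¬ Indep 𝓔 (insert (v s) (run 𝓔 v b J s)))
    (hb : b s = true) :
    ∃ e ∈ 𝓔, v s ∈ e ∧ (∀ r ∈ recent v (e, s), b r = true) ∧
      ∃ u ∈ e, u ≠ v s ∧ ¬ (u ∈ run 𝓔 v b I s ↔ u ∈ run 𝓔 v b J s) := by
  simp only [Indep, not_forall, not_not] at h2
  obtain ⟨e, he, hsub⟩ := h2
  have hocc : ∀ u ∈ e, u ≠ v s → u ∈ run 𝓔 v b J s := fun u hu hne =>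
    (Finset.mem_insert.1 (hsub hu)).resolve_left hne
  have hse : v s ∈ e := by
    by_contra hse
    exact indep_run hJ s e he fun u hu => hocc u hu fun h => hse (h ▸ hu)
  obtain ⟨u, hu, hu'⟩ := Finset.not_subset.1 (h1 e he)
  have hne : u ≠ v s := fun h => hu' (by simp [h])
  refine ⟨e, he, hse, fun r hr => ?_, u, hu, hne, fun h =>
    hu' (Finset.mem_insert_of_mem (h.2 (hocc u hu hne)))⟩
  obtain ⟨hrs, hre, hr⟩ := mem_recent.1 hr
  change r ≤ s at hrs
  rcases hrs.lt_or_eq with hlt | rfl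
  · exact bit_eq_true_of_mem hJ hlt (fun τ h1 h2 => hr τ h1 h2.le)
      (hocc _ hre fun h => hr s hlt le_rfl h.symm)
  · exact hb

/-- A discrepancy at the last update of a vertex is caused by an earlier discrepancy in
a hyperedge all of whose most recent bits are `true`. -/
lemma exists_earlier_discrepancy (hI : Indep 𝓔 I) (hJ : Indep 𝓔 J) {s t : ℕ} (hst : s < t)
    (hlast : ∀ τ, s < τ → τ < t → v τ ≠ v s)
    (hne : ¬ (v s ∈ run 𝓔 v b I t ↔ v s ∈ run 𝓔 v b J t)) :
    ∃ e ∈ 𝓔, v s ∈ e ∧ (∀ r ∈ recent v (e, s), b r = true) ∧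
      ∃ u ∈ e, u ≠ v s ∧ ¬ (u ∈ run 𝓔 v b I s ↔ u ∈ run 𝓔 v b J s) := by
  have hlast' : ∀ τ, s + 1 ≤ τ → τ < t → v τ ≠ v s := fun τ h1 h2 => hlast τ h1 h2
  rw [mem_run_iff_of_not_updated (s := s + 1) hst hlast',
    mem_run_iff_of_not_updated (s := s + 1) hst hlast', run, run,
    mem_update_self (indep_run hI s), mem_update_self (indep_run hJ s)] at hne
  have hb : b s = true := by
    by_contra hb
    simp [hb] at hne
  by_cases h1 : Indep 𝓔 (insert (v s) (run 𝓔 v b I s))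
  · exact exists_blocking_edge hJ h1 (fun h2 => hne (by simp [h1, h2])) hb
  · obtain ⟨e, he, hse, hr, u, hu, hus, hd⟩ := exists_blocking_edge (J := I) (I := J) hI
      (by by_contra h2; exact hne (by simp [h1, h2])) h1 hb
    exact ⟨e, he, hse, hr, u, hu, hus, fun h => hd h.symm⟩

/-- A discrepancy is traced back in time to the window `[a, c)`. -/
lemma exists_linked_chain (hI : Indep 𝓔 I) (hJ : Indep 𝓔 J) {a c : ℕ} (hcov : Covers v a c)
    {t : ℕ} {w : V} (hct : c ≤ t) (hne : ¬ (w ∈ run 𝓔 v b I t ↔ w ∈ run 𝓔 v b J t)) :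
    ∃ x l, x.2 < t ∧ v x.2 = w ∧ (∀ τ, x.2 < τ → τ < t → v τ ≠ w) ∧
      List.IsChain (Linked v) (x :: l) ∧ endTime x l < c ∧
      ∀ y ∈ x :: l, y.1 ∈ 𝓔 ∧ a ≤ y.2 ∧ v y.2 ∈ y.1 ∧ ∀ r ∈ recent v y, b r = true := by
  induction t using Nat.strong_induction_on generalizing w with
  | _ t ih =>
    obtain ⟨s₀, has₀, hs₀c, hs₀⟩ := hcov w
    obtain ⟨s, hst, rfl, hlast⟩ := exists_last_update (t := t) ⟨s₀, by omega, hs₀⟩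
    have has : a ≤ s := by
      by_contra has
      exact hlast s₀ (by omega) (by omega) hs₀
    obtain ⟨e, he, hse, hgood, u, hu, hus, hd⟩ := exists_earlier_discrepancy hI hJ hst hlast hne
    by_cases hsc : s < c
    · exact ⟨(e, s), [], hst, rfl, hlast, List.isChain_singleton _, hsc, by
        simpa using ⟨he, has, hse, hgood⟩⟩
    · obtain ⟨x, l, hxs, rfl, hx, hch, hend, hall⟩ := ih s hst (by omega) hd
      refine ⟨(e, s), x :: l, hst, rfl, hlast, ?_, hend, ?_⟩
      · refine List.isChain_cons_cons.2 ⟨⟨hxs, mem_recent.2 ⟨hxs.le, hu, fun τ h1 h2 => ?_⟩,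
          (hall x List.mem_cons_self).2.2.1⟩, hch⟩
        change τ ≤ s at h2
        rcases h2.lt_or_eq with h2 | rfl
        exacts [hx τ h1 h2, hus.symm]
      · intro y hy
        rcases List.mem_cons.1 hy with rfl | hy
        exacts [⟨he, has, hse, hgood⟩, hall y hy]

end Dynamics

/-! ### The expected weight of chains -/

section Paths

variable {V : Type*} [Fintype V]

open Classical in
/-- The lists `l` of `m` nodes from `S` for which `x :: l` is a chain for the relation `r`. -/
def paths (r : Finset V × ℕ → Finset V × ℕ → Prop) (S : Finset (Finset V × ℕ)) :
    ℕ → Finset V × ℕ → Finset (List (Finset V × ℕ))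
  | 0, _ => {[]}
  | m + 1, x => (S.filter (r x)).biUnion fun y => (paths r S m y).image (List.cons y)

open Classical in
/-- The sum of the weights `tilt V ^ (x.2 - endTime x l)` over the paths `x :: l` with `m` steps,
in recursive form. -/
def weight (r : Finset V × ℕ → Finset V × ℕ → Prop) (S : Finset (Finset V × ℕ)) :
    ℕ → Finset V × ℕ → ℝ
  | 0, _ => 1
  | m + 1, x => ∑ y ∈ S, if r x y then tilt V ^ (x.2 - y.2) * weight r S m y else 0

variable {r : Finset V × ℕ → Finset V × ℕ → Prop} {S : Finset (Finset V × ℕ)}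

omit [Fintype V] in
lemma mem_paths {x : Finset V × ℕ} {l : List (Finset V × ℕ)} (h : List.IsChain r (x :: l))
    (hS : ∀ y ∈ l, y ∈ S) : l ∈ paths r S l.length x := by
  induction l generalizing x with
  | nil => simp [paths]
  | cons y l ih =>
    rw [List.isChain_cons_cons] at h
    simp only [paths, List.length_cons, Finset.mem_biUnion, Finset.mem_filter, Finset.mem_image]
    exact ⟨y, ⟨hS y (by simp), h.1⟩, l, ih h.2 fun z hz => hS z (by simp [hz]), rfl⟩

omit [Fintype V] in
lemma mem_of_mem_paths {m : ℕ} {x : Finset V × ℕ} {l : List (Finset V × ℕ)}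
    (h : l ∈ paths r S m x) : l.length = m ∧ ∀ y ∈ l, y ∈ S := by
  induction m generalizing x l with
  | zero => simp only [paths, Finset.mem_singleton] at h; simp [h]
  | succ m ih =>
    simp only [paths, Finset.mem_biUnion, Finset.mem_filter, Finset.mem_image] at h
    obtain ⟨y, hy, l, hl, rfl⟩ := h
    obtain ⟨h1, h2⟩ := ih hl
    simpa [h1, hy.1] using fun a b hab => h2 (a, b) hab

omit [Fintype V] in
lemma endTime_le_of_mem_paths (hr : ∀ x y, r x y → y.2 < x.2) {m : ℕ} {x : Finset V × ℕ}
    {l : List (Finset V × ℕ)} (h : l ∈ paths r S m x) : endTime x l ≤ x.2 := by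
  induction m generalizing x l with
  | zero => simp only [paths, Finset.mem_singleton] at h; simp [h, endTime]
  | succ m ih =>
    simp only [paths, Finset.mem_biUnion, Finset.mem_filter, Finset.mem_image] at h
    obtain ⟨y, hy, l, hl, rfl⟩ := h
    exact (ih hl).trans (hr x y hy.2).le

omit [Fintype V] in
lemma length_le_of_isChain (hr : ∀ x y, r x y → y.2 < x.2) {x : Finset V × ℕ}
    {l : List (Finset V × ℕ)} (h : List.IsChain r (x :: l)) : l.length ≤ x.2 := by
  induction l generalizing x with
  | nil => simp
  | cons y l ih =>
    rw [List.isChain_cons_cons] at h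
    have := ih h.2
    have := hr _ _ h.1
    simp only [List.length_cons]
    omega

lemma weight_nonneg (m : ℕ) (x : Finset V × ℕ) : 0 ≤ weight r S m x := by
  induction m generalizing x with
  | zero => exact zero_le_one
  | succ m ih =>
    refine Finset.sum_nonneg fun y _ => ?_
    split_ifs
    exacts [mul_nonneg (pow_nonneg tilt_pos.le _) (ih y), le_rfl]

lemma sum_paths_le_weight (hr : ∀ x y, r x y → y.2 < x.2) (m : ℕ) (x : Finset V × ℕ) :
    ∑ l ∈ paths r S m x, tilt V ^ (x.2 - endTime x l) ≤ weight r S m x := by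
  classical
  induction m generalizing x with
  | zero => simp [paths, weight, endTime]
  | succ m ih =>
    rw [paths, weight, ← Finset.sum_filter]
    rw [Finset.sum_biUnion]
    · refine Finset.sum_le_sum fun y hy => ?_
      rw [Finset.sum_image fun _ _ _ _ h => List.tail_eq_of_cons_eq h]
      refine le_trans (le_of_eq ?_)
        (mul_le_mul_of_nonneg_left (ih y) (pow_nonneg tilt_pos.le (x.2 - y.2)))
      rw [Finset.mul_sum]
      refine Finset.sum_congr rfl fun l hl => ?_
      have h1 := endTime_le_of_mem_paths hr hl
      have h2 := hr x y (Finset.mem_filter.1 hy).2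
      rw [← pow_add, endTime]
      congr 1
      omega
    · intro y _ z _ hyz
      refine Finset.disjoint_left.2 fun l hl hl' => hyz ?_
      obtain ⟨l₁, -, rfl⟩ := Finset.mem_image.1 hl
      obtain ⟨l₂, -, h⟩ := Finset.mem_image.1 hl'
      exact (List.head_eq_of_cons_eq h).symm

end Paths

section StepBound

variable {V : Type*} [Fintype V] [Inhabited V]

/-- The relation `step v x y` depends only on the updates before the time of `x`. -/
def Predictable (step : (ℕ → V) → Finset V × ℕ → Finset V × ℕ → Prop) : Prop :=
  ∀ v v' x y, (∀ s < x.2, v s = v' s) → (step v x y ↔ step v' x y)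

open Classical in
/-- Whatever the weights `φ` of the nodes are, as long as they depend only on the past, the
expected weight of all steps from a node is at most `K` times the maximal expected weight of a
node. -/
def StepBound (𝓔 : Finset (Finset V))
    (step : (ℕ → V) → Finset V × ℕ → Finset V × ℕ → Prop) (K : ℝ) : Prop :=
  ∀ (T : ℕ) (φ : (ℕ → V) → Finset V × ℕ → ℝ) (B : ℝ), 0 ≤ B → (∀ v x, 0 ≤ φ v x) →
    (∀ x, DependsOn (fun v => φ v x) (Set.Iio x.2)) →
    (∀ f ∈ 𝓔, ∀ s < T, avg T (fun v => φ v (f, s)) ≤ B) →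
    ∀ e ∈ 𝓔, ∀ t < T, avg T (fun v => ∑ y ∈ 𝓔 ×ˢ Finset.range T,
      if step v (e, t) y then tilt V ^ (t - y.2) * φ v y else 0) ≤ K * B

variable {𝓔 : Finset (Finset V)} {step step' : (ℕ → V) → Finset V × ℕ → Finset V × ℕ → Prop}
  {K K' : ℝ}

omit [Inhabited V] in
lemma dependsOn_weight (hp : Predictable step) (hlt : ∀ v x y, step v x y → y.2 < x.2)
    (S : Finset (Finset V × ℕ)) (m : ℕ) (x : Finset V × ℕ) :
    DependsOn (fun v => weight (step v) S m x) (Set.Iio x.2) := by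
  induction m generalizing x with
  | zero => exact fun _ _ _ => rfl
  | succ m ih =>
    intro v v' h
    refine Finset.sum_congr rfl fun y _ => ?_
    rw [hp v v' x y h]
    split_ifs with hs
    · congr 1
      exact ih y fun s hs' => h s (lt_trans hs' (hlt v' x y hs))
    · rfl

lemma StepBound.avg_weight_le (hK : StepBound 𝓔 step K) (hK0 : 0 ≤ K) (hp : Predictable step)
    (hlt : ∀ v x y, step v x y → y.2 < x.2) {T : ℕ} (m : ℕ) {e : Finset V} (he : e ∈ 𝓔) {t : ℕ}
    (ht : t < T) :
    avg T (fun v => weight (step v) (𝓔 ×ˢ Finset.range T) m (e, t)) ≤ K ^ m := by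
  induction m generalizing e t with
  | zero => simp [weight, avg_const]
  | succ m ih =>
    rw [pow_succ']
    exact hK T (fun v => weight (step v) (𝓔 ×ˢ Finset.range T) m) (K ^ m) (pow_nonneg hK0 m)
      (fun v x => weight_nonneg m x) (dependsOn_weight hp hlt _ m) (fun f hf s hs => ih hf hs)
      e he t ht

lemma StepBound.or (hK : StepBound 𝓔 step K) (hK' : StepBound 𝓔 step' K') :
    StepBound 𝓔 (fun v x y => step v x y ∨ step' v x y) (K + K') := by
  intro T φ B hB hφ hdep havg e he t ht
  rw [add_mul]
  refine le_trans ?_ (add_le_add (hK T φ B hB hφ hdep havg e he t ht)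
    (hK' T φ B hB hφ hdep havg e he t ht))
  rw [← avg_add]
  refine avg_mono fun v => ?_
  rw [← Finset.sum_add_distrib]
  refine Finset.sum_le_sum fun y _ => ?_
  have : 0 ≤ tilt V ^ (t - y.2) * φ v y := mul_nonneg (pow_nonneg tilt_pos.le _) (hφ v y)
  split_ifs <;> simp_all

omit [Fintype V] [Inhabited V] in
lemma predictable_jump : Predictable (Jump (V := V)) := by
  have key : ∀ (v v' : ℕ → V) (x y : Finset V × ℕ), (∀ s < x.2, v s = v' s) →
      Jump v x y → Jump v' x y := by
    rintro v v' x y h ⟨hyx, hy, w, hwx, hwy, hw⟩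
    exact ⟨hyx, h _ hyx ▸ hy, w, hwx, hwy, fun τ h1 h2 => h τ h2 ▸ hw τ h1 h2⟩
  exact fun v v' x y h => ⟨key v v' x y h, key v' v x y fun s hs => (h s hs).symm⟩

omit [Fintype V] [Inhabited V] in
lemma predictable_hop : Predictable (Hop (V := V)) := by
  have key : ∀ (v v' : ℕ → V) (x y : Finset V × ℕ), (∀ s < x.2, v s = v' s) →
      Hop v x y → Hop v' x y := by
    rintro v v' x y h ⟨s, hys, hsx, hs, ⟨w, hwx, hw⟩, hyx, hyy, hy⟩
    have hy2 := h _ (hys.trans hsx)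
    exact ⟨s, hys, hsx, h s hsx ▸ hs, ⟨w, hwx, fun τ h1 h2 => h τ h2 ▸ hw τ h1 h2⟩,
      hy2 ▸ hyx, hy2 ▸ hyy, fun τ h1 h2 => by
        rw [← h τ (h2.trans hsx), ← hy2]; exact hy τ h1 h2⟩
  exact fun v v' x y h => ⟨key v v' x y h, key v' v x y fun s hs => (h s hs).symm⟩

omit [Fintype V] [Inhabited V] in
lemma lt_of_hop {v : ℕ → V} {x y : Finset V × ℕ} (h : Hop v x y) : y.2 < x.2 := by
  obtain ⟨s, h1, h2, -⟩ := h
  exact h1.trans h2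

variable [DecidableEq V]

open Classical in
omit [Inhabited V] in
lemma sum_jump_le_search {φ : Finset V × ℕ → ℝ} (hφ : ∀ x, 0 ≤ φ x) (v : ℕ → V)
    (e : Finset V) {t T : ℕ} (ht : t < T) :
    ∑ y ∈ 𝓔 ×ˢ Finset.range T, (if Jump v (e, t) y then tilt V ^ (t - y.2) * φ y else 0) ≤
      ∑ w ∈ e, ∑ f ∈ 𝓔 with w ∈ f, search w f (fun s => φ (f, s)) v t := by
  simp only [Finset.sum_filter]
  rw [Finset.sum_product, Finset.sum_comm (s := e)]
  refine Finset.sum_le_sum fun f _ => ?_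
  have hsub : ∑ s ∈ Finset.range T,
      (if Jump v (e, t) (f, s) then tilt V ^ (t - s) * φ (f, s) else 0) =
      ∑ s ∈ Finset.range t,
        (if Jump v (e, t) (f, s) then tilt V ^ (t - s) * φ (f, s) else 0) := by
    refine (Finset.sum_subset (Finset.range_subset_range.2 ht.le) fun s _ hs => ?_).symm
    exact if_neg fun h => hs (Finset.mem_range.2 h.1)
  have hswap : ∑ w ∈ e, (if w ∈ f then search w f (fun s => φ (f, s)) v t else 0) =
      ∑ s ∈ Finset.range t, ∑ w ∈ e, if w ∈ f ∧ v s ∈ f ∧ ∀ τ, s < τ → τ < t → v τ ≠ w then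
        tilt V ^ (t - s) * φ (f, s) else 0 := by
    rw [Finset.sum_comm]
    refine Finset.sum_congr rfl fun w _ => ?_
    rw [search_eq_sum]
    split_ifs with hw <;> simp [hw]
  rw [hsub, hswap]
  refine Finset.sum_le_sum fun s _ => ?_
  have hX : 0 ≤ tilt V ^ (t - s) * φ (f, s) := mul_nonneg (pow_nonneg tilt_pos.le _) (hφ _)
  have hnn : ∀ w ∈ e, 0 ≤ if w ∈ f ∧ v s ∈ f ∧ ∀ τ, s < τ → τ < t → v τ ≠ w then
      tilt V ^ (t - s) * φ (f, s) else 0 := fun w _ => by split_ifs <;> simp [hX]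
  split_ifs with h
  · obtain ⟨_, hs, w, hwe, hwf, hw⟩ := h
    exact le_trans (le_of_eq (if_pos ⟨hwf, hs, hw⟩).symm) (Finset.single_le_sum hnn hwe)
  · exact Finset.sum_nonneg hnn

open Classical in
omit [Inhabited V] in
lemma sum_hop_le_search {φ : Finset V × ℕ → ℝ} (hφ : ∀ x, 0 ≤ φ x) (v : ℕ → V)
    (e : Finset V) {t T : ℕ} (ht : t < T) :
    ∑ y ∈ 𝓔 ×ˢ Finset.range T, (if Hop v (e, t) y then tilt V ^ (t - y.2) * φ y else 0) ≤
      ∑ w ∈ e, ∑ u ∈ e, ∑ f ∈ 𝓔 with u ∈ f,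
        search w e (fun s => search u {u} (fun r => φ (f, r)) v s) v t := by
  simp only [Finset.sum_filter]
  have hcomm : ∀ g : V → V → Finset V → ℝ,
      ∑ w ∈ e, ∑ u ∈ e, ∑ f ∈ 𝓔, g w u f = ∑ f ∈ 𝓔, ∑ w ∈ e, ∑ u ∈ e, g w u f := fun g => by
    rw [Finset.sum_comm (s := 𝓔)]
    exact Finset.sum_congr rfl fun w _ => Finset.sum_comm
  rw [Finset.sum_product, hcomm]
  refine Finset.sum_le_sum fun f _ => ?_
  have hswap : ∑ w ∈ e, ∑ u ∈ e,
      (if u ∈ f then search w e (fun s => search u {u} (fun r => φ (f, r)) v s) v t else 0) =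
      ∑ r ∈ Finset.range T, ∑ q ∈ e ×ˢ e ×ˢ Finset.range t,
        if q.2.1 ∈ f ∧ (v q.2.2 ∈ e ∧ ∀ τ, q.2.2 < τ → τ < t → v τ ≠ q.1) ∧ r < q.2.2 ∧
          v r = q.2.1 ∧ ∀ τ, r < τ → τ < q.2.2 → v τ ≠ q.2.1
        then tilt V ^ (t - q.2.2) * (tilt V ^ (q.2.2 - r) * φ (f, r)) else 0 := by
    rw [Finset.sum_comm (s := Finset.range T), Finset.sum_product]
    refine Finset.sum_congr rfl fun w _ => ?_
    rw [Finset.sum_product]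
    refine Finset.sum_congr rfl fun u _ => ?_
    by_cases hu : u ∈ f
    · simp only [hu, if_true, true_and]
      rw [search_eq_sum]
      refine Finset.sum_congr rfl fun s hs => ?_
      have hr : Finset.range s = (Finset.range T).filter (· < s) := by
        have := Finset.mem_range.1 hs
        ext r
        simp only [Finset.mem_range, Finset.mem_filter]
        omega
      rw [search_eq_sum, hr, Finset.sum_filter, Finset.mul_sum]
      by_cases hA : v s ∈ e ∧ ∀ τ, s < τ → τ < t → v τ ≠ w
      · rw [if_pos hA]
        refine Finset.sum_congr rfl fun r _ => ?_
        rw [← ite_and, mul_ite, mul_zero]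
        refine if_congr ?_ rfl rfl
        rw [Finset.mem_singleton]
        exact ⟨fun h => ⟨hA, h⟩, fun h => h.2⟩
      · rw [if_neg hA]
        exact (Finset.sum_eq_zero fun r _ => if_neg fun h => hA h.1).symm
    · simp [hu]
  rw [hswap]
  refine Finset.sum_le_sum fun r _ => ?_
  have hX : ∀ s, 0 ≤ tilt V ^ (t - s) * (tilt V ^ (s - r) * φ (f, r)) := fun s =>
    mul_nonneg (pow_nonneg tilt_pos.le _) (mul_nonneg (pow_nonneg tilt_pos.le _) (hφ _))
  have hnn : ∀ q ∈ e ×ˢ e ×ˢ Finset.range t, 0 ≤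
      if q.2.1 ∈ f ∧ (v q.2.2 ∈ e ∧ ∀ τ, q.2.2 < τ → τ < t → v τ ≠ q.1) ∧ r < q.2.2 ∧
        v r = q.2.1 ∧ ∀ τ, r < τ → τ < q.2.2 → v τ ≠ q.2.1
      then tilt V ^ (t - q.2.2) * (tilt V ^ (q.2.2 - r) * φ (f, r)) else 0 := fun q _ => by
    split_ifs
    exacts [hX _, le_rfl]
  split_ifs with h
  · obtain ⟨s, hrs, hst, hs, ⟨w, hwe, hw⟩, hre, hrf, hr⟩ := h
    refine le_trans (le_of_eq ?_) (Finset.single_le_sum hnn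
      (Finset.mk_mem_product hwe (Finset.mk_mem_product hre (Finset.mem_range.2 hst))))
    dsimp only at hrs hst ⊢
    rw [if_pos ⟨hrf, ⟨hs, hw⟩, hrs, rfl, hr⟩, ← mul_assoc, ← pow_add]
    congr 2
    omega
  · exact Finset.sum_nonneg hnn

/-- For a `k`-uniform family of hyperedges of degree at most `Δ`, a jump from a node has at most
`k * Δ` choices of a common vertex and a new hyperedge, and the search for the time contributes
`3 / 2 * k`. -/
lemma stepBound_jump {k Δ : ℕ} (hk : ∀ e ∈ 𝓔, e.card = k)
    (hΔ : ∀ w : V, (𝓔.filter (w ∈ ·)).card ≤ Δ) :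
    StepBound 𝓔 Jump (3 / 2 * Δ * k ^ 2) := by
  intro T φ B hB hφ hdep havg e he t ht
  refine (avg_mono fun v => sum_jump_le_search (hφ v) v e ht).trans ?_
  simp only [avg_sum]
  calc ∑ w ∈ e, ∑ f ∈ 𝓔 with w ∈ f, avg T (fun v => search w f (fun s => φ v (f, s)) v t)
      ≤ ∑ w ∈ e, ∑ f ∈ 𝓔 with w ∈ f, 3 / 2 * k * B := by
        refine Finset.sum_le_sum fun w _ => Finset.sum_le_sum fun f hf => ?_
        have hf := (Finset.mem_filter.1 hf).1
        rw [← hk f hf]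
        exact avg_search_le w f (φ := fun v s => φ v (f, s)) (fun s => hdep (f, s)) hB
          (havg f hf) ht.le
    _ ≤ ∑ w ∈ e, Δ * (3 / 2 * k * B) := by
        refine Finset.sum_le_sum fun w _ => ?_
        rw [Finset.sum_const, nsmul_eq_mul]
        have : ((𝓔.filter (w ∈ ·)).card : ℝ) ≤ Δ := by exact_mod_cast hΔ w
        gcongr
    _ = 3 / 2 * Δ * k ^ 2 * B := by
        rw [Finset.sum_const, nsmul_eq_mul, hk e he]
        ring

/-- For a hop there are `k * k * Δ` choices of the guard, the common vertex and the new
hyperedge, and the two searches contribute `3 / 2 * k` and `3 / 2`. -/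
lemma stepBound_hop {k Δ : ℕ} (hk : ∀ e ∈ 𝓔, e.card = k)
    (hΔ : ∀ w : V, (𝓔.filter (w ∈ ·)).card ≤ Δ) :
    StepBound 𝓔 Hop (9 / 4 * Δ * k ^ 3) := by
  intro T φ B hB hφ hdep havg e he t ht
  refine (avg_mono fun v => sum_hop_le_search (hφ v) v e ht).trans ?_
  simp only [avg_sum]
  calc ∑ w ∈ e, ∑ u ∈ e, ∑ f ∈ 𝓔 with u ∈ f,
        avg T (fun v => search w e (fun s => search u {u} (fun r => φ v (f, r)) v s) v t)
      ≤ ∑ w ∈ e, ∑ u ∈ e, ∑ f ∈ 𝓔 with u ∈ f, 3 / 2 * k * (3 / 2 * B) := by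
        refine Finset.sum_le_sum fun w _ => Finset.sum_le_sum fun u _ =>
          Finset.sum_le_sum fun f hf => ?_
        have hf := (Finset.mem_filter.1 hf).1
        rw [← hk e he]
        refine avg_search_le w e (φ := fun v s => search u {u} (fun r => φ v (f, r)) v s)
          (fun s => dependsOn_search u {u} (φ := fun v r => φ v (f, r)) (fun r => hdep (f, r)) s)
          (by positivity) (fun s hs => ?_) ht.le
        have := avg_search_le u {u} (φ := fun v r => φ v (f, r)) (fun r => hdep (f, r)) hB
          (havg f hf) hs.le
        simpa using this
    _ ≤ ∑ w ∈ e, ∑ u ∈ e, Δ * (3 / 2 * k * (3 / 2 * B)) := by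
        refine Finset.sum_le_sum fun w _ => Finset.sum_le_sum fun u _ => ?_
        rw [Finset.sum_const, nsmul_eq_mul]
        have : ((𝓔.filter (u ∈ ·)).card : ℝ) ≤ Δ := by exact_mod_cast hΔ u
        gcongr
    _ = 9 / 4 * Δ * k ^ 3 * B := by
        rw [Finset.sum_const, Finset.sum_const, nsmul_eq_mul, nsmul_eq_mul, hk e he]
        ring

end StepBound

/-! ### The probability of a discrepancy -/

section Discrepancy

variable {V : Type*} [Fintype V] [DecidableEq V] [Inhabited V]

/-- Given the updated vertices `v`, every chain of linked nodes can be shortened to a chain for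
`step v` which gains a factor `γ` for each of its nodes. -/
def Shortens (𝓔 : Finset (Finset V)) (step : (ℕ → V) → Finset V × ℕ → Finset V × ℕ → Prop) (γ : ℝ)
    (a : ℕ) : Prop :=
  ∀ v : ℕ → V, Covers v 0 a → Covers v (2 * a) (3 * a) →
    ∀ x l, List.IsChain (Linked v) (x :: l) → (∀ y ∈ x :: l, y.1 ∈ 𝓔 ∧ a ≤ y.2) →
      endTime x l < 2 * a →
      ∃ l', l' ⊆ l ∧ List.IsChain (step v) (x :: l') ∧ endTime x l' < 3 * a ∧
        (1 / 2 : ℝ) ^ (bits v (x :: l')).card ≤ γ ^ (l'.length + 1)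

variable {𝓔 : Finset (Finset V)} {step : (ℕ → V) → Finset V × ℕ → Finset V × ℕ → Prop}
  {γ K : ℝ} {a T : ℕ} {I J : Finset V}

omit [Inhabited V] in
open Classical in
/-- For good sequences of updated vertices, the probability of a discrepancy over the random bits
is at most the weighted number of shortened chains that span most of the time interval. -/
lemma avg_bits_discrepancy_le (hI : Indep 𝓔 I) (hJ : Indep 𝓔 J) (hγ : 0 ≤ γ)
    (hlt : ∀ v x y, step v x y → y.2 < x.2) (hsh : Shortens 𝓔 step γ a) (haT : 2 * a ≤ T)
    {v : ℕ → V} (h0 : Covers v 0 a) (h1 : Covers v a (2 * a)) (h2 : Covers v (2 * a) (3 * a))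
    (h3 : Covers v (T - a) T) :
    avg T (fun b => if run 𝓔 v b I T ≠ run 𝓔 v b J T then (1 : ℝ) else 0) ≤
      ∑ m ∈ Finset.range T, ∑ x ∈ 𝓔 ×ˢ Finset.Ico (T - a) T,
        γ ^ (m + 1) / tilt V ^ (T - 4 * a) * weight (step v) (𝓔 ×ˢ Finset.range T) m x := by
  set good : Finset V × ℕ → List (Finset V × ℕ) → Prop := fun x l =>
    endTime x l < 3 * a ∧ (1 / 2 : ℝ) ^ (bits v (x :: l)).card ≤ γ ^ (l.length + 1) with hgood
  set P : ℕ → Finset V × ℕ → Finset (List (Finset V × ℕ)) := fun m x =>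
    (paths (step v) (𝓔 ×ˢ Finset.range T) m x).filter (good x) with hP
  have hexists : ∀ b : ℕ → Bool, run 𝓔 v b I T ≠ run 𝓔 v b J T →
      ∃ m ∈ Finset.range T, ∃ x ∈ 𝓔 ×ˢ Finset.Ico (T - a) T, ∃ l ∈ P m x,
        ∀ s ∈ bits v (x :: l), b s = true := by
    intro b hb
    obtain ⟨w, hw⟩ : ∃ w, ¬ (w ∈ run 𝓔 v b I T ↔ w ∈ run 𝓔 v b J T) := by
      by_contra! h
      exact hb (Finset.ext h)
    obtain ⟨x, l, hxT, hxw, hx, hch, hend, hall⟩ := exists_linked_chain hI hJ h1 haT hw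
    obtain ⟨l', hl', hch', hend', hbits⟩ := hsh v h0 h2 x l hch
      (fun y hy => ⟨(hall y hy).1, (hall y hy).2.1⟩) hend
    have hle := length_le_of_isChain (hlt v) hch'
    have hxa : T - a ≤ x.2 := by
      obtain ⟨s, hs1, hs2, hs⟩ := h3 w
      by_contra hxa
      exact hx s (by omega) hs2 hs
    refine ⟨l'.length, Finset.mem_range.2 (by omega), x, Finset.mem_product.2
      ⟨(hall x (by simp)).1, Finset.mem_Ico.2 ⟨hxa, hxT⟩⟩, l', Finset.mem_filter.2
      ⟨mem_paths hch' fun y hy => ?_, hend', hbits⟩, fun s hs => ?_⟩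
    · refine Finset.mem_product.2 ⟨(hall y (List.mem_cons_of_mem _ (hl' hy))).1,
        Finset.mem_range.2 ?_⟩
      exact (lt_and_mem_of_isChain_linked hch y (hl' hy)).1.trans hxT
    · obtain ⟨y, hy, hsy⟩ := mem_bits.1 hs
      exact (hall y (List.cons_subset_cons x hl' hy)).2.2.2 s hsy
  have hbound : ∀ m ∈ Finset.range T, ∀ x ∈ 𝓔 ×ˢ Finset.Ico (T - a) T, ∀ l ∈ P m x,
      avg T (fun b => if ∀ s ∈ bits v (x :: l), b s = true then (1 : ℝ) else 0) ≤
        γ ^ (m + 1) / tilt V ^ (T - 4 * a) * tilt V ^ (x.2 - endTime x l) := by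
    intro m _ x hx l hl
    obtain ⟨hl, hend, hbits⟩ := Finset.mem_filter.1 hl
    obtain ⟨hlen, hlS⟩ := mem_of_mem_paths hl
    have hx2 := Finset.mem_Ico.1 (Finset.mem_product.1 hx).2
    have hS : ∀ s ∈ bits v (x :: l), s < T := by
      intro s hs
      obtain ⟨y, hy, hsy⟩ := mem_bits.1 hs
      refine lt_of_le_of_lt (mem_recent.1 hsy).1 ?_
      rcases List.mem_cons.1 hy with rfl | hy
      · exact hx2.2
      · exact Finset.mem_range.1 (Finset.mem_product.1 (hlS y hy)).2
    rw [avg_forall_eq_true hS, div_mul_eq_mul_div, mul_div_assoc]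
    rw [hlen] at hbits
    refine hbits.trans (le_mul_of_one_le_right (pow_nonneg hγ _) ?_)
    rw [one_le_div (pow_pos tilt_pos _)]
    exact pow_le_pow_right₀ one_le_tilt (by omega)
  calc avg T (fun b => if run 𝓔 v b I T ≠ run 𝓔 v b J T then (1 : ℝ) else 0)
      ≤ avg T (fun b => if ∃ m ∈ Finset.range T, ∃ x ∈ 𝓔 ×ˢ Finset.Ico (T - a) T, ∃ l ∈ P m x,
          ∀ s ∈ bits v (x :: l), b s = true then (1 : ℝ) else 0) := by
        refine avg_mono fun b => ?_
        by_cases hb : run 𝓔 v b I T ≠ run 𝓔 v b J T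
        · rw [if_pos hb, if_pos (hexists b hb)]
        · rw [if_neg hb]
          split_ifs <;> norm_num
    _ ≤ ∑ m ∈ Finset.range T, ∑ x ∈ 𝓔 ×ˢ Finset.Ico (T - a) T, ∑ l ∈ P m x,
          avg T (fun b => if ∀ s ∈ bits v (x :: l), b s = true then (1 : ℝ) else 0) :=
        (avg_exists_le T _ _).trans <| Finset.sum_le_sum fun m _ =>
          (avg_exists_le T _ _).trans <| Finset.sum_le_sum fun x _ => avg_exists_le T _ _
    _ ≤ _ := by
        refine Finset.sum_le_sum fun m hm => Finset.sum_le_sum fun x hx => ?_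
        refine (Finset.sum_le_sum (hbound m hm x hx)).trans ?_
        rw [← Finset.mul_sum]
        refine mul_le_mul_of_nonneg_left ?_
          (div_nonneg (pow_nonneg hγ _) (pow_nonneg tilt_pos.le _))
        refine le_trans (Finset.sum_le_sum_of_subset_of_nonneg (Finset.filter_subset _ _)
          fun l _ _ => pow_nonneg tilt_pos.le _) (sum_paths_le_weight (hlt v) m x)

open Classical in
lemma avg_not_covers_le {c d : ℕ} (hcd : c ≤ d) (hdT : d ≤ T) :
    avg T (fun v : ℕ → V => if ¬ Covers v c d then (1 : ℝ) else 0) ≤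
      Fintype.card V * (1 - 1 / Fintype.card V) ^ (d - c) := by
  calc avg T (fun v : ℕ → V => if ¬ Covers v c d then (1 : ℝ) else 0)
      ≤ avg T (fun v : ℕ → V => if ∃ u ∈ Finset.univ, ∀ s, c ≤ s → s < d → v s ≠ u
          then (1 : ℝ) else 0) := by
        refine avg_mono fun v => le_of_eq ?_
        congr 1
        simp [Covers]
    _ ≤ ∑ u : V, avg T (fun v : ℕ → V => if ∀ s, c ≤ s → s < d → v s ≠ u
          then (1 : ℝ) else 0) := by
        convert avg_exists_le T Finset.univ fun u (v : ℕ → V) => ∀ s, c ≤ s → s < d → v s ≠ u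
    _ = _ := by
        simp only [avg_forall_ne _ hcd hdT, Finset.sum_const, Finset.card_univ, nsmul_eq_mul]

open Classical in
/-- The probability that two copies of the dynamics driven by the same randomness differ. -/
lemma avg_discrepancy_le (hI : Indep 𝓔 I) (hJ : Indep 𝓔 J) (hγ : 0 ≤ γ) (hK : 0 ≤ K)
    (hlt : ∀ v x y, step v x y → y.2 < x.2) (hp : Predictable step) (hsb : StepBound 𝓔 step K)
    (hsh : Shortens 𝓔 step γ a) (hγK : γ * K ≤ 3 / 4) (haT : 3 * a ≤ T) :
    avg T (fun ω : ℕ → V × Bool => if run 𝓔 (fun s => (ω s).1) (fun s => (ω s).2) I T ≠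
        run 𝓔 (fun s => (ω s).1) (fun s => (ω s).2) J T then (1 : ℝ) else 0) ≤
      4 * (Fintype.card V * (1 - 1 / Fintype.card V) ^ a) +
        4 * (𝓔.card * a * γ / tilt V ^ (T - 4 * a)) := by
  rw [avg_prod]
  have hpt : ∀ v : ℕ → V,
      avg T (fun b => if run 𝓔 v b I T ≠ run 𝓔 v b J T then (1 : ℝ) else 0) ≤
        (if ¬ Covers v 0 a then (1 : ℝ) else 0) + (if ¬ Covers v a (2 * a) then (1 : ℝ) else 0) +
        (if ¬ Covers v (2 * a) (3 * a) then (1 : ℝ) else 0) +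
        (if ¬ Covers v (T - a) T then (1 : ℝ) else 0) +
        ∑ m ∈ Finset.range T, ∑ x ∈ 𝓔 ×ˢ Finset.Ico (T - a) T,
          γ ^ (m + 1) / tilt V ^ (T - 4 * a) * weight (step v) (𝓔 ×ˢ Finset.range T) m x := by
    intro v
    have hle1 : avg T (fun b => if run 𝓔 v b I T ≠ run 𝓔 v b J T then (1 : ℝ) else 0) ≤ 1 :=
      (avg_mono (h := fun _ => 1) fun b => by split_ifs <;> norm_num).trans_eq (avg_const _ _)
    have hW : 0 ≤ ∑ m ∈ Finset.range T, ∑ x ∈ 𝓔 ×ˢ Finset.Ico (T - a) T,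
        γ ^ (m + 1) / tilt V ^ (T - 4 * a) * weight (step v) (𝓔 ×ˢ Finset.range T) m x :=
      Finset.sum_nonneg fun m _ => Finset.sum_nonneg fun x _ =>
        mul_nonneg (div_nonneg (pow_nonneg hγ _) (pow_nonneg tilt_pos.le _)) (weight_nonneg _ _)
    by_cases h0 : Covers v 0 a
    · by_cases h1 : Covers v a (2 * a)
      · by_cases h2 : Covers v (2 * a) (3 * a)
        · by_cases h3 : Covers v (T - a) T
          · simpa only [h0, h1, h2, h3, not_true_eq_false, if_false, add_zero, zero_add] using
              avg_bits_discrepancy_le hI hJ hγ hlt hsh (by omega) h0 h1 h2 h3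
          · rw [if_pos h3]
            refine hle1.trans ?_
            split_ifs
            linarith
        · rw [if_pos h2]
          refine hle1.trans ?_
          split_ifs <;> linarith
      · rw [if_pos h1]
        refine hle1.trans ?_
        split_ifs <;> linarith
    · rw [if_pos h0]
      refine hle1.trans ?_
      split_ifs <;> linarith
  refine (avg_mono hpt).trans ?_
  simp only [avg_add, avg_sum, avg_const_mul]
  have c0 := avg_not_covers_le (V := V) (T := T) (c := 0) (d := a) (by omega) (by omega)
  have c1 := avg_not_covers_le (V := V) (T := T) (c := a) (d := 2 * a) (by omega) (by omega)
  have c2 := avg_not_covers_le (V := V) (T := T) (c := 2 * a) (d := 3 * a) (by omega) (by omega)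
  have c3 := avg_not_covers_le (V := V) (T := T) (c := T - a) (d := T) (by omega) (by omega)
  rw [show a - 0 = a by omega] at c0
  rw [show 2 * a - a = a by omega] at c1
  rw [show 3 * a - 2 * a = a by omega] at c2
  rw [show T - (T - a) = a by omega] at c3
  have hsum : ∑ m ∈ Finset.range T, ∑ x ∈ 𝓔 ×ˢ Finset.Ico (T - a) T,
      γ ^ (m + 1) / tilt V ^ (T - 4 * a) *
        avg T (fun v => weight (step v) (𝓔 ×ˢ Finset.range T) m x) ≤
      4 * (𝓔.card * a * γ / tilt V ^ (T - 4 * a)) := by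
    have hc : 0 ≤ γ / tilt V ^ (T - 4 * a) := div_nonneg hγ (pow_nonneg tilt_pos.le _)
    calc _ ≤ ∑ m ∈ Finset.range T, ∑ x ∈ 𝓔 ×ˢ Finset.Ico (T - a) T,
          (3 / 4 : ℝ) ^ m * (γ / tilt V ^ (T - 4 * a)) := by
          refine Finset.sum_le_sum fun m _ => Finset.sum_le_sum fun x hx => ?_
          obtain ⟨hx1, hx2⟩ := Finset.mem_product.1 hx
          have hw := hsb.avg_weight_le hK hp hlt m hx1 (Finset.mem_Ico.1 hx2).2
          calc _ ≤ γ ^ (m + 1) / tilt V ^ (T - 4 * a) * K ^ m := by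
                refine mul_le_mul_of_nonneg_left hw ?_
                exact div_nonneg (pow_nonneg hγ _) (pow_nonneg tilt_pos.le _)
            _ = (γ * K) ^ m * (γ / tilt V ^ (T - 4 * a)) := by
                rw [mul_pow, pow_succ]
                ring
            _ ≤ _ := by
                refine mul_le_mul_of_nonneg_right ?_ hc
                exact pow_le_pow_left₀ (mul_nonneg hγ hK) hγK m
      _ = (∑ m ∈ Finset.range T, (3 / 4 : ℝ) ^ m) *
            (𝓔.card * a * (γ / tilt V ^ (T - 4 * a))) := by
          rw [Finset.sum_mul]
          refine Finset.sum_congr rfl fun m _ => ?_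
          rw [Finset.sum_const, Finset.card_product, Nat.card_Ico, nsmul_eq_mul,
            show T - (T - a) = a by omega]
          push_cast
          ring
      _ ≤ 4 * (𝓔.card * a * (γ / tilt V ^ (T - 4 * a))) := by
          refine mul_le_mul_of_nonneg_right ?_ (by positivity)
          rw [geom_sum_eq (by norm_num)]
          have : (0 : ℝ) ≤ (3 / 4) ^ T := by positivity
          rw [div_le_iff_of_neg (by norm_num)]
          linarith
      _ = _ := by ring
  linarith

end Discrepancy

/-! ### Random bits of shortened chains -/

section Shortening

variable {V : Type*} [Fintype V] [DecidableEq V]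

omit [Fintype V] in
/-- In a separated chain every second node has its own `k` random bits. -/
lemma shortens_jump {𝓔 : Finset (Finset V)} {k a : ℕ} {γ : ℝ} (hk : ∀ e ∈ 𝓔, e.card = k)
    (hγ : 0 ≤ γ) (hγk : γ ^ 2 = (1 / 2) ^ k) : Shortens 𝓔 Jump γ a := by
  intro v h0 _ x l hch hall hend
  obtain ⟨l', hl', hch', hend', hsep⟩ := exists_separated_jump_chain l x hch
  refine ⟨l', hl', hch', by omega, ?_⟩
  have hcard := mul_length_le_two_mul_card_bits (k := k) (x :: l') (fun y hy => by
    have hy := hall y (List.cons_subset_cons x hl' hy)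
    exact hk y.1 hy.1 ▸ card_le_card_recent h0 hy.2) hsep
  rw [List.length_cons] at hcard
  rw [← pow_le_pow_iff_left₀ (by positivity) (pow_nonneg hγ _) two_ne_zero, ← pow_mul, ← pow_mul,
    mul_comm _ 2, mul_comm _ 2, pow_mul γ, hγk, ← pow_mul]
  exact pow_le_pow_of_le_one (by norm_num) (by norm_num) hcard

omit [Fintype V] in
/-- In the linear case every node has at least `k - 1` random bits of its own. -/
lemma shortens_hop {𝓔 : Finset (Finset V)} {k a : ℕ} (hk : ∀ e ∈ 𝓔, e.card = k)
    (hlin : ∀ e ∈ 𝓔, ∀ f ∈ 𝓔, e ≠ f → (e ∩ f).card ≤ 1) :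
    Shortens 𝓔 (fun v x y => Jump v x y ∨ Hop v x y) (2 * (1 / 2) ^ k) a := by
  intro v h0 h2 x l hch hall hend
  obtain ⟨l', hl', hch', hend', hsep, hone⟩ := exists_separated_hop_chain hlin h2 l x hch
    (fun y hy => (hall y hy).1) hend (by omega)
  refine ⟨l', hl', hch', hend', ?_⟩
  have hcard := mul_length_le_card_bits_add (k := k) (x :: l') (fun y hy => by
    have hy := hall y (List.cons_subset_cons x hl' hy)
    exact hk y.1 hy.1 ▸ card_le_card_recent h0 hy.2) hsep hone
  rw [List.length_cons] at hcard
  calc (1 / 2 : ℝ) ^ (bits v (x :: l')).card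
      = 2 ^ (l'.length + 1) * (1 / 2) ^ ((bits v (x :: l')).card + (l'.length + 1)) := by
        rw [pow_add _ (bits v (x :: l')).card, mul_left_comm, ← mul_pow]
        norm_num
    _ ≤ 2 ^ (l'.length + 1) * (1 / 2) ^ (k * (l'.length + 1)) := by
        gcongr ?_ * ?_
        exact pow_le_pow_of_le_one (by norm_num) (by norm_num) hcard
    _ = (2 * (1 / 2) ^ k) ^ (l'.length + 1) := by rw [mul_pow, ← pow_mul]

end Shortening

end UpdateSeq

namespace Hypergraph

open UpdateSeq

/-! ### The Glauber dynamics driven by random updates -/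

section Glauber

variable {V : Type*} [Fintype V] [DecidableEq V] (H : Hypergraph V)

open Classical in
/-- The hyperedges as finite sets. -/
def edgeFinset : Finset (Finset V) := Finset.univ.filter fun e => (e : Set V) ∈ E(H)

variable {H}

omit [DecidableEq V] in
lemma mem_edgeFinset {e : Finset V} : e ∈ H.edgeFinset ↔ (e : Set V) ∈ E(H) := by
  simp [edgeFinset]

omit [DecidableEq V] in
lemma indep_edgeFinset_iff {I : Finset V} : Indep H.edgeFinset I ↔ H.IsIndep I := by
  classical
  refine ⟨fun h e he hsub => ?_, fun h e he hsub =>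
    h e (mem_edgeFinset.1 he) (Finset.coe_subset.2 hsub)⟩
  have he' : ((e.toFinset : Finset V) : Set V) = e := Set.coe_toFinset e
  exact h e.toFinset (mem_edgeFinset.2 (he'.symm ▸ he)) (Finset.coe_subset.1 (he'.symm ▸ hsub))

variable (H) in
/-- The update of an independent set at the vertex `p.1` with random bit `p.2`. -/
def update (p : V × Bool) (σ : H.IndepSet) : H.IndepSet :=
  if p.2 then H.update1 p.1 σ else H.update0 p.1 σ

lemma coe_update (p : V × Bool) (σ : H.IndepSet) :
    (H.update p σ : Finset V) = UpdateSeq.update H.edgeFinset p.1 p.2 σ := by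
  simp only [update, UpdateSeq.update, update1, update0]
  split_ifs with h1 h2 h3 h3
  · rfl
  · exact absurd (indep_edgeFinset_iff.2 h2) h3
  · exact absurd (indep_edgeFinset_iff.1 h3) h2
  · rfl
  · rfl

variable (H) in
/-- The Glauber dynamics started from `σ` and driven by the updates `ω`. -/
def trajectory (ω : ℕ → V × Bool) (σ : H.IndepSet) : ℕ → H.IndepSet
  | 0 => σ
  | t + 1 => H.update (ω t) (trajectory ω σ t)

lemma coe_trajectory (ω : ℕ → V × Bool) (σ : H.IndepSet) (t : ℕ) :
    (H.trajectory ω σ t : Finset V) =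
      run H.edgeFinset (fun s => (ω s).1) (fun s => (ω s).2) σ t := by
  induction t with
  | zero => rfl
  | succ t ih => rw [trajectory, coe_update, ih, run]

lemma glauber_apply (σ τ : H.IndepSet) :
    H.glauber σ τ =
      (∑ p : V × Bool, if H.update p σ = τ then (1 : ℝ) else 0) / Fintype.card (V × Bool) := by
  rw [Fintype.sum_prod_type, Fintype.card_prod, Fintype.card_bool, Finset.sum_div]
  refine Finset.sum_congr rfl fun v _ => ?_
  simp only [Fintype.sum_bool, update, if_true, Bool.false_eq_true, if_false]
  push_cast
  simp only [div_eq_mul_inv, mul_inv]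
  ring

omit [Fintype V] in
lemma dependsOn_trajectory (σ : H.IndepSet) (t : ℕ) :
    DependsOn (fun ω => H.trajectory ω σ t) (Set.Iio t) := by
  induction t with
  | zero => exact fun _ _ _ => rfl
  | succ t ih =>
    intro ω ω' h
    have := ih fun s hs => h s (lt_trans hs (Nat.lt_succ_self t))
    dsimp only at this
    simp only [trajectory, this, h t (Nat.lt_succ_self t)]

/-- The `T`-step transition probabilities are those of the random trajectory. -/
lemma glauber_pow_apply [Inhabited V] (T : ℕ) (σ τ : H.IndepSet) :
    (H.glauber ^ T) σ τ =
      avg T fun ω => if H.trajectory ω σ T = τ then (1 : ℝ) else 0 := by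
  induction T generalizing τ with
  | zero =>
    rw [pow_zero, Matrix.one_apply]
    exact if_congr Iff.rfl rfl rfl
  | succ T ih =>
    have htraj : ∀ (ω : ℕ → V × Bool) (p : V × Bool),
        H.trajectory (Function.update ω T p) σ T = H.trajectory ω σ T := fun ω p =>
      dependsOn_trajectory σ T fun s hs => Function.update_of_ne (ne_of_lt hs) _ _
    rw [pow_succ, Matrix.mul_apply]
    simp only [ih, glauber_apply, avg, trajectory, htraj, Function.update_self]
    simp only [mul_div_assoc', ← Finset.sum_div]
    congr 1
    simp only [← avg_sum, mul_comm (avg _ _), ← avg_const_mul]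
    congr 1
    funext ω
    simp

omit [Fintype V] in
lemma update0_eq_iff_update1_eq {σ τ : H.IndepSet} (h : σ ≠ τ) (v : V) :
    H.update0 v σ = τ ↔ H.update1 v τ = σ := by
  constructor
  · rintro rfl
    have hv : v ∈ σ.1 := by
      by_contra hv
      exact h (Subtype.ext (Finset.erase_eq_of_notMem hv).symm)
    have hins : insert v (H.update0 v σ).1 = σ.1 := Finset.insert_erase hv
    have hind : H.IsIndep (insert v (H.update0 v σ).1) := hins ▸ σ.2
    rw [update1, dif_pos hind]
    exact Subtype.ext hins
  · intro hσ
    rw [update1] at hσ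
    split_ifs at hσ with hind
    · have hv : v ∉ τ.1 := fun hv => h (hσ ▸ Subtype.ext (Finset.insert_eq_of_mem hv))
      subst hσ
      exact Subtype.ext (Finset.erase_insert hv)
    · exact absurd hσ.symm h

/-- The Glauber dynamics is reversible with respect to the uniform distribution. -/
lemma glauber_comm (σ τ : H.IndepSet) : H.glauber σ τ = H.glauber τ σ := by
  by_cases h : σ = τ
  · rw [h]
  · simp only [glauber, update0_eq_iff_update1_eq h, update0_eq_iff_update1_eq (Ne.symm h)]
    refine Finset.sum_congr rfl fun v _ => ?_
    ring

lemma sum_glauber_pow_left [Nonempty V] (T : ℕ) (τ : H.IndepSet) :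
    ∑ σ, (H.glauber ^ T) σ τ = 1 := by
  induction T generalizing τ with
  | zero => simp [Matrix.one_apply]
  | succ T ih =>
    simp only [pow_succ, Matrix.mul_apply]
    rw [Finset.sum_comm]
    simp only [← Finset.sum_mul, ih, one_mul, glauber_comm _ τ]
    simp only [glauber_apply]
    rw [← Finset.sum_div, Finset.sum_comm]
    simp

/-- The distance to the uniform distribution is at most the maximal probability that two
trajectories driven by the same updates differ. -/
lemma tvDist_glauber_pow_le [Inhabited V] {T : ℕ} {D : ℝ}
    (hD : ∀ σ τ : H.IndepSet, avg T (fun ω =>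
      if H.trajectory ω σ T ≠ H.trajectory ω τ T then (1 : ℝ) else 0) ≤ D) (σ : H.IndepSet) :
    tvDist ((H.glauber ^ T) σ) H.uniformIndep ≤ D := by
  set N : ℝ := (Fintype.card H.IndepSet : ℝ) with hN
  have hNpos : 0 < N := by
    have : Nonempty H.IndepSet := ⟨σ⟩
    exact Nat.cast_pos.2 Fintype.card_pos
  have hpair : ∀ τ : H.IndepSet,
      ∑ ρ, |(H.glauber ^ T) σ ρ - (H.glauber ^ T) τ ρ| ≤ 2 * D := by
    intro τ
    have hsub : ∀ ρ, (H.glauber ^ T) σ ρ - (H.glauber ^ T) τ ρ = avg T fun ω =>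
        (if H.trajectory ω σ T = ρ then (1 : ℝ) else 0) +
          (-1) * if H.trajectory ω τ T = ρ then (1 : ℝ) else 0 := fun ρ => by
      rw [avg_add, avg_const_mul, glauber_pow_apply, glauber_pow_apply]
      ring
    calc ∑ ρ, |(H.glauber ^ T) σ ρ - (H.glauber ^ T) τ ρ|
        ≤ ∑ ρ, avg T fun ω => |(if H.trajectory ω σ T = ρ then (1 : ℝ) else 0) +
          (-1) * if H.trajectory ω τ T = ρ then (1 : ℝ) else 0| := by
          refine Finset.sum_le_sum fun ρ _ => ?_
          rw [hsub]
          exact abs_avg_le _ _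
      _ ≤ avg T fun ω => 2 * if H.trajectory ω σ T ≠ H.trajectory ω τ T then (1 : ℝ) else 0 := by
          rw [← avg_sum]
          refine avg_mono fun ω => ?_
          by_cases h : H.trajectory ω σ T = H.trajectory ω τ T
          · rw [if_neg (not_not.2 h), h, mul_zero]
            exact (Finset.sum_eq_zero fun ρ _ => by
              rw [neg_one_mul, add_neg_cancel, abs_zero]).le
          · rw [if_pos h]
            calc _ ≤ ∑ ρ, ((if H.trajectory ω σ T = ρ then (1 : ℝ) else 0) +
                  if H.trajectory ω τ T = ρ then (1 : ℝ) else 0) := by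
                  refine Finset.sum_le_sum fun ρ _ => ?_
                  split_ifs <;> norm_num
              _ = 2 * 1 := by
                  rw [Finset.sum_add_distrib]
                  simp
                  norm_num
      _ ≤ 2 * D := by
          rw [avg_const_mul]
          have := hD σ τ
          linarith
  have hmean : ∀ ρ, (H.glauber ^ T) σ ρ - H.uniformIndep ρ =
      (∑ τ, ((H.glauber ^ T) σ ρ - (H.glauber ^ T) τ ρ)) / N := fun ρ => by
    rw [Finset.sum_sub_distrib, sum_glauber_pow_left, uniformIndep]
    simp only [Finset.sum_const, Finset.card_univ, nsmul_eq_mul, ← hN]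
    field_simp
  calc tvDist ((H.glauber ^ T) σ) H.uniformIndep
      ≤ 1 / 2 * ∑ ρ, (∑ τ, |(H.glauber ^ T) σ ρ - (H.glauber ^ T) τ ρ|) / N := by
        unfold tvDist
        gcongr with ρ
        rw [hmean, abs_div, abs_of_pos hNpos]
        gcongr
        exact Finset.abs_sum_le_sum_abs _ _
    _ = 1 / 2 * ((∑ τ, ∑ ρ, |(H.glauber ^ T) σ ρ - (H.glauber ^ T) τ ρ|) / N) := by
        rw [← Finset.sum_div, Finset.sum_comm]
    _ ≤ 1 / 2 * ((∑ _τ : H.IndepSet, 2 * D) / N) := by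
        gcongr with τ
        exact hpair τ
    _ = D := by
        rw [Finset.sum_const, Finset.card_univ, nsmul_eq_mul, ← hN]
        field_simp

lemma mixingTime_le_of_tvDist_lt {ε : ℝ} {T : ℕ}
    (h : ∀ σ : H.IndepSet, tvDist ((H.glauber ^ T) σ) H.uniformIndep < ε) :
    ∃ t : ℕ, H.mixingTime ε = (t : ℕ∞) ∧ t ≤ T := by
  have hle : H.mixingTime ε ≤ (T : ℕ∞) := sInf_le ⟨T, h, rfl⟩
  obtain ⟨t, ht⟩ := ENat.ne_top_iff_exists.1 (ne_top_of_le_ne_top (ENat.natCast_ne_top T) hle)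
  exact ⟨t, ht.symm, by exact_mod_cast ht.trans_le hle⟩

end Glauber

/-! ### The mixing time -/

section Mixing

variable {V : Type*} [Fintype V] [DecidableEq V] {H : Hypergraph V} {k Δ : ℕ}

omit [DecidableEq V] in
lemma IsUniform.card_eq (hk : H.IsUniform k) : ∀ e ∈ H.edgeFinset, e.card = k := fun e he => by
  rw [← hk _ (mem_edgeFinset.1 he), Set.ncard_coe_finset]

lemma IsLinear.card_inter_le_one (hlin : H.IsLinear) :
    ∀ e ∈ H.edgeFinset, ∀ f ∈ H.edgeFinset, e ≠ f → (e ∩ f).card ≤ 1 := fun e he f hf hef => by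
  have := hlin e (mem_edgeFinset.1 he) f (mem_edgeFinset.1 hf) fun h => hef (Finset.coe_injective h)
  rwa [← Finset.coe_inter, Set.ncard_coe_finset] at this

open Classical in
lemma card_filter_mem_le_of_maxDegree_eq (hΔ : H.maxDegree = Δ) (w : V) :
    (H.edgeFinset.filter (w ∈ ·)).card ≤ Δ := by
  have hle : H.degree w ≤ Δ := hΔ ▸ Finset.le_sup (f := fun v => H.degree v) (Finset.mem_univ w)
  refine le_trans ?_ hle
  rw [degree, ← Set.ncard_coe_finset, ← Set.ncard_image_of_injective _ Finset.coe_injective]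
  refine Set.ncard_le_ncard ?_ (Set.toFinite _)
  rintro _ ⟨e, he, rfl⟩
  have he := Finset.mem_filter.1 (Finset.mem_coe.1 he)
  exact ⟨mem_edgeFinset.1 he.1, he.2⟩

lemma card_edgeFinset_le (hk : H.IsUniform k) (hk1 : 1 ≤ k) (hΔ : H.maxDegree = Δ) :
    H.edgeFinset.card ≤ Fintype.card V * Δ := by
  classical
  calc H.edgeFinset.card
      ≤ (Finset.univ.biUnion fun w : V => H.edgeFinset.filter (w ∈ ·)).card := by
        refine Finset.card_le_card fun e he => ?_
        obtain ⟨w, hw⟩ := Finset.card_pos.1 (by rw [hk.card_eq e he]; omega : 0 < e.card)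
        exact Finset.mem_biUnion.2 ⟨w, Finset.mem_univ w, Finset.mem_filter.2 ⟨he, hw⟩⟩
    _ ≤ ∑ w : V, (H.edgeFinset.filter (w ∈ ·)).card := Finset.card_biUnion_le
    _ ≤ ∑ _w : V, Δ := Finset.sum_le_sum fun w _ => card_filter_mem_le_of_maxDegree_eq hΔ w
    _ = Fintype.card V * Δ := by simp

lemma one_sub_inv_pow_mul_le {n : ℕ} (hn : 1 ≤ n) (m : ℕ) :
    (1 - 1 / (n : ℝ)) ^ (n * m) ≤ (1 / 2) ^ m := by
  have hn' : (1 : ℝ) ≤ n := by exact_mod_cast hn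
  have h0 : 0 ≤ 1 - 1 / (n : ℝ) := by
    rw [sub_nonneg, div_le_one (by linarith)]
    exact hn'
  rw [pow_mul]
  refine pow_le_pow_left₀ (pow_nonneg h0 n) ?_ m
  refine (Real.one_sub_div_pow_le_exp_neg hn').trans ?_
  rw [Real.exp_neg, ← one_div]
  refine one_div_le_one_div_of_le (by norm_num) ?_
  linarith [Real.add_one_le_exp (1 : ℝ)]

/-- If chains of nodes lose more through the random bits than they gain through the number of
choices, the dynamics mixes in time `O(n log n)`. -/
lemma mixingTime_le_of_stepBound [Inhabited V]
    {step : (ℕ → V) → Finset V × ℕ → Finset V × ℕ → Prop} {γ K : ℝ}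
    (hn : 2 ≤ Fintype.card V) (hk : H.IsUniform k) (hk1 : 1 ≤ k) (hΔ : H.maxDegree = Δ)
    (hγ : 0 ≤ γ) (hK : 0 ≤ K) (hlt : ∀ v x y, step v x y → y.2 < x.2) (hp : Predictable step)
    (hsb : StepBound H.edgeFinset step K) (hsh : ∀ a, Shortens H.edgeFinset step γ a)
    (hγK : γ * K ≤ 3 / 4) (hΔγ : Δ * γ ≤ 1) :
    ∃ t : ℕ, H.mixingTime (1 / 4) = (t : ℕ∞) ∧
      (t : ℝ) ≤ 208 * (Fintype.card V : ℝ) * Real.log (Fintype.card V : ℝ) := by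
  classical
  set n := Fintype.card V with hn_def
  set l := Nat.clog 2 n with hl
  -- `a` is the length of the windows in which all vertices are updated, and `4 * n * (3 * l + 12)`
  -- is the time that the chains have to span.
  set a := n * (l + 6) with ha
  set T := 4 * a + 4 * n * (3 * l + 12) with hT
  have hn1 : (1 : ℝ) ≤ n := by exact_mod_cast (by omega : 1 ≤ n)
  have hnl : (n : ℝ) ≤ 2 ^ l := by exact_mod_cast Nat.le_pow_clog one_lt_two n
  have hl6 : ((l + 6 : ℕ) : ℝ) ≤ 2 ^ (l + 6) := by exact_mod_cast (Nat.lt_two_pow_self).le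
  have hD : ∀ σ τ : H.IndepSet, avg T (fun ω =>
      if H.trajectory ω σ T ≠ H.trajectory ω τ T then (1 : ℝ) else 0) ≤ 1 / 8 := by
    intro σ τ
    have hdisc := avg_discrepancy_le (indep_edgeFinset_iff.2 σ.2) (indep_edgeFinset_iff.2 τ.2)
      hγ hK hlt hp hsb (hsh a) hγK (T := T) (by omega)
    have hrw : ∀ ω, (if H.trajectory ω σ T ≠ H.trajectory ω τ T then (1 : ℝ) else 0) =
        if run H.edgeFinset (fun s => (ω s).1) (fun s => (ω s).2) σ T ≠
          run H.edgeFinset (fun s => (ω s).1) (fun s => (ω s).2) τ T then (1 : ℝ) else 0 := by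
      intro ω
      rw [← coe_trajectory, ← coe_trajectory]
      exact if_congr (not_congr Subtype.ext_iff) rfl rfl
    simp only [hrw]
    refine hdisc.trans ?_
    have h1 : (n : ℝ) * (1 - 1 / n) ^ a ≤ 1 / 64 := by
      calc (n : ℝ) * (1 - 1 / n) ^ a ≤ 2 ^ l * (1 / 2) ^ (l + 6) := by
            refine mul_le_mul hnl (one_sub_inv_pow_mul_le (by omega) (l + 6)) (pow_nonneg ?_ _)
              (by positivity)
            rw [sub_nonneg, div_le_one (by linarith)]
            exact hn1
        _ = (2 * (1 / 2)) ^ l * (1 / 2) ^ 6 := by rw [pow_add, mul_pow]; ring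
        _ = 1 / 64 := by norm_num
    have h2 : H.edgeFinset.card * a * γ / tilt V ^ (T - 4 * a) ≤ 1 / 64 := by
      have htilt := two_pow_le_tilt_pow (V := V) (3 * l + 12)
      rw [← hn_def] at htilt
      rw [show T - 4 * a = 4 * n * (3 * l + 12) by omega]
      have hE : (H.edgeFinset.card : ℝ) ≤ n * Δ := by
        exact_mod_cast card_edgeFinset_le hk hk1 hΔ
      have hnum : H.edgeFinset.card * a * γ ≤ 2 ^ (3 * l + 6) := by
        calc H.edgeFinset.card * a * γ ≤ n * Δ * a * γ := by gcongr
          _ = n * (n * (l + 6 : ℕ)) * (Δ * γ) := by rw [ha]; push_cast; ring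
          _ ≤ 2 ^ l * (2 ^ l * 2 ^ (l + 6)) * 1 := by gcongr
          _ = 2 ^ (3 * l + 6) := by ring
      calc H.edgeFinset.card * a * γ / tilt V ^ (4 * n * (3 * l + 12))
          ≤ 2 ^ (3 * l + 6) / 2 ^ (3 * l + 12) := by gcongr
        _ = 1 / 64 := by
          rw [show 3 * l + 12 = (3 * l + 6) + 6 by ring, pow_add _ (3 * l + 6) 6]
          field_simp
          norm_num
    linarith
  obtain ⟨t, ht, htT⟩ := mixingTime_le_of_tvDist_lt (ε := 1 / 4) fun σ =>
    (tvDist_glauber_pow_le hD σ).trans_lt (by norm_num)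
  refine ⟨t, ht, ?_⟩
  have hlog2 : 1 / 2 ≤ Real.log 2 := by linarith [Real.log_two_gt_d9]
  have hlogn : Real.log 2 ≤ Real.log n :=
    Real.log_le_log (by norm_num) (by exact_mod_cast hn)
  have hlog : (l : ℝ) * Real.log 2 ≤ Real.log 2 + Real.log n := by
    have hpow : 2 ^ (l - 1) < n := Nat.pow_pred_clog_lt_self one_lt_two (by omega)
    have hl1 : 1 ≤ l := Nat.clog_pos one_lt_two hn
    have := Real.log_le_log (by positivity) (by exact_mod_cast hpow.le : (2 : ℝ) ^ (l - 1) ≤ n)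
    rw [Real.log_pow, Nat.cast_sub hl1] at this
    push_cast at this
    linarith
  have hl4 : (l : ℝ) ≤ 4 * Real.log n := by
    by_contra! h
    nlinarith
  calc (t : ℝ) ≤ T := by exact_mod_cast htT
    _ = 8 * n * (2 * l + 9) := by rw [hT, ha]; push_cast; ring
    _ ≤ 8 * n * (2 * (4 * Real.log n) + 9 * (2 * Real.log n)) := by
      gcongr
      linarith
    _ = 208 * n * Real.log n := by ring

end Mixing

end Hypergraph

end

theorem theorem4 :
    ∃ C : ℝ, 0 < C ∧
      ∀ (V : Type*) [Fintype V] [DecidableEq V] (H : Hypergraph V) (k Δ : ℕ),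
        H.vertexSet = Set.univ →
        2 ≤ Fintype.card V →
        1 ≤ k →
        H.IsUniform k →
        H.maxDegree = Δ →
        ((Δ : ℝ) ≤ (2 : ℝ) ^ ((k : ℝ) / 2) / (Real.sqrt 8 * (k : ℝ) ^ 2) ∨
          ((Δ : ℝ) ≤ (2 : ℝ) ^ k / (9 * (k : ℝ) ^ 3) ∧ H.IsLinear)) →
        ∃ t : ℕ, H.mixingTime (1 / 4) = (t : ℕ∞) ∧
          (t : ℝ) ≤ C * (Fintype.card V : ℝ) * Real.log (Fintype.card V : ℝ) := by
  classical
  refine ⟨208, by norm_num, fun V _ _ H k Δ _ hn hk1 hk hΔ hcond => ?_⟩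
  have : Nonempty V := Fintype.card_pos_iff.1 (by omega)
  have : Inhabited V := Classical.inhabited_of_nonempty this
  have hk' : (1 : ℝ) ≤ k := by exact_mod_cast hk1
  have hdeg := Hypergraph.card_filter_mem_le_of_maxDegree_eq hΔ
  have hΔ0 : (0 : ℝ) ≤ Δ := Nat.cast_nonneg Δ
  rcases hcond with hcond | ⟨hcond, hlin⟩
  · set g : ℝ := (2 : ℝ) ^ ((k : ℝ) / 2) with hg
    have hg0 : 0 < g := Real.rpow_pos_of_pos (by norm_num) _
    have hg2 : g ^ 2 = 2 ^ k := by
      rw [hg, ← Real.rpow_natCast, ← Real.rpow_mul (by norm_num), ← Real.rpow_natCast]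
      congr 1
      push_cast
      ring
    have h8 : 2 ≤ Real.sqrt 8 := Real.le_sqrt_of_sq_le (by norm_num)
    rw [le_div_iff₀ (by positivity)] at hcond
    -- `√8 ≥ 2` leaves room for the factor `3 / 2` of a backward search.
    have hmain : 2 * (Δ * (k : ℝ) ^ 2) ≤ g := by
      refine le_trans ?_ hcond
      nlinarith [mul_nonneg hΔ0 (sq_nonneg (k : ℝ))]
    refine Hypergraph.mixingTime_le_of_stepBound (step := UpdateSeq.Jump) (γ := g⁻¹)
      (K := 3 / 2 * Δ * k ^ 2) hn hk hk1 hΔ (by positivity) (by positivity)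
      (fun v x y h => h.1) UpdateSeq.predictable_jump
      (UpdateSeq.stepBound_jump hk.card_eq hdeg)
      (fun a => UpdateSeq.shortens_jump hk.card_eq (by positivity) ?_) ?_ ?_
    · rw [inv_pow, hg2, one_div, inv_pow]
    · rw [inv_mul_le_iff₀ hg0]
      linarith
    · rw [← div_eq_mul_inv, div_le_one hg0]
      nlinarith [mul_nonneg hΔ0 (by nlinarith : (0 : ℝ) ≤ (k : ℝ) ^ 2 - 1)]
  · have h2k : (0 : ℝ) < 2 ^ k := by positivity
    rw [le_div_iff₀ (by positivity)] at hcond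
    have hγ : (2 * (1 / 2) ^ k : ℝ) = 2 / 2 ^ k := by rw [one_div, inv_pow]; rfl
    have hk3 : (1 : ℝ) ≤ (k : ℝ) ^ 3 := one_le_pow₀ hk'
    refine Hypergraph.mixingTime_le_of_stepBound
      (step := fun v x y => UpdateSeq.Jump v x y ∨ UpdateSeq.Hop v x y) (γ := 2 * (1 / 2) ^ k)
      (K := 3 / 2 * Δ * k ^ 2 + 9 / 4 * Δ * k ^ 3) hn hk hk1 hΔ (by positivity) (by positivity)
      (fun v x y h => h.elim (fun h => h.1) UpdateSeq.lt_of_hop)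
      (fun v v' x y h => or_congr (UpdateSeq.predictable_jump v v' x y h)
        (UpdateSeq.predictable_hop v v' x y h))
      ((UpdateSeq.stepBound_jump hk.card_eq hdeg).or (UpdateSeq.stepBound_hop hk.card_eq hdeg))
      (fun a => UpdateSeq.shortens_hop hk.card_eq hlin.card_inter_le_one) ?_ ?_
    · rw [hγ, div_mul_eq_mul_div, div_le_iff₀ h2k]
      rcases Nat.lt_or_ge k 2 with hk2 | hk2
      -- For `k = 1` the degree condition excludes hyperedges.
      · obtain rfl : k = 1 := by omega
        have : Δ = 0 := by
          have : (Δ : ℝ) < 1 := by norm_num at hcond; linarith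
          exact Nat.lt_one_iff.1 (by exact_mod_cast this)
        subst this
        norm_num
      · have hk2' : (2 : ℝ) ≤ k := by exact_mod_cast hk2
        have : (k : ℝ) ^ 2 * 2 ≤ k ^ 3 := by
          rw [pow_succ (k : ℝ) 2]
          gcongr
        nlinarith [mul_le_mul_of_nonneg_left this hΔ0]
    · rw [hγ, mul_div_assoc', div_le_one h2k]
      nlinarith [mul_le_mul_of_nonneg_left hk3 hΔ0]
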